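/- Let $n\ge 1$, $s\in(0,1)$, $p:=\max\{2,\tfrac{n}{2s}\}$, and let $\Omega\subseteq\mathbb R^n$ be open. Write $a\cdot b=\sum_i a_ib_i$ for the (bilinear) dot product on $\mathbb C^n$, and $\langle f,g\rangle=\int f\cdot g$ for the corresponding bilinear pairings on $\mathbb R^n$ and $\mathbb R^{2n}$. For $A:\mathbb R^n\times\mathbb R^n\to\mathbb C^n$ measurable put $$A_s(x,y)=\tfrac12\big(A(x,y)+A(y,x)\big),\qquad A_a=A-A_s,\qquad A_\parallel(x,y)=\begin{cases}\frac{A(x,y)\cdot(x-y)}{|x-y|^2}(x-y)&x\ne y\\ A(x,y)&x=y\end{cases},$$ $A_{s\parallel}=(A_s)_\parallel$, $A_{a\parallel}=(A_a)_\parallel$, and $\mathcal J_1A(x)=\big(\int|A(y,x)|^2dy\big)^{1/2}$, $\mathcal J_2A(x)=\big(\int|A(x,y)|^2dy\big)^{1/2}$. Let $\mathcal P_0$ be the set of pairs $(A,q)$ with $A:\mathbb R^{2n}\to\mathbb C^n$ measurable and $q:\mathbb R^n\to\mathbb R$ such that (p1) $\mathcal J_1A,\mathcal J_2A\in L^{2p}(\mathbb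 R^n)$; (p2) $A_{s\parallel}\in H^{sp-s}(\mathbb R^{2n},\mathbb C^n)$; (p3) $A_{a\parallel}(x,y)\cdot(y-x)$ is real and $\ge0$ for a.e. $(x,y)$; (p4) $q\in L^p(\Omega)$, with $q=0$ a.e. outside $\Omega$. Let $\mathcal C_{n,s}=\frac{4^s\Gamma(n/2+s)}{\pi^{n/2}|\Gamma(-s)|}$ be the constant for which $\mathcal C_{n,s}\,\mathrm{PV}\!\int\frac{u(x)-u(y)}{|x-y|^{n+2s}}dy$ has Fourier symbol $|\xi|^{2s}$, and let $\alpha(x,y)=\sqrt{\mathcal C_{n,s}/2}\,\frac{y-x}{|y-x|^{n/2+s+1}}$. For $u\in H^s(\mathbb R^n)$ (complex-valued) set $\nabla^su(x,y)=(u(x)-u(y))\alpha(x,y)$ and $\nabla^s_Au(x,y)=\nabla^su(x,y)+A(x,y)u(x)$. Let $(\nabla\cdot)^s:L^2(\mathbb R^{2n})\to H^{-s}(\mathbb R^n)$ be given by $\langle(\nabla\cdot)^sw,u\rangle=\langle w,\nabla^su\rangle$, and for $(A,q)\in\mathcal P_0$ let $(-\Delta)^s_A:H^s(\mathbb R^n)\to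 H^{-s}(\mathbb R^n)$ be given by $\langle(-\Delta)^s_Au,v\rangle=\langle\nabla^s_Au,\nabla^s_Av\rangle$ for all $v\in H^s(\mathbb R^n)$. Finally, define the distribution on $\mathbb R^n$ $$Q:=q+\int_{\mathbb R^n}A\cdot A\,dy+(\nabla\cdot)^sA_{s\parallel},$$ where $A\cdot A=\sum_iA_i(x,y)^2$, which is $|A|^2$ if $A$ is real-valued; define $Q'$ in the same way from $(A',q')$. **Lemma.** Let $(A,q),(A',q')\in\mathcal P_0$. Then $(-\Delta)^s_Au+qu=(-\Delta)^s_{A'}u+q'u$ in $H^{-s}(\mathbb R^n)$ for all $u\in H^s(\mathbb R^n)$ if and only if $A_{a\parallel}=A'_{a\parallel}$ a.e. in $\mathbb R^{2n}$ and $Q=Q'$ as distributions on $\mathbb R^n$. -/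

import Mathlib

open MeasureTheory
open scoped ENNReal ContDiff SchwartzMap

noncomputable section

namespace FracMag

/-- `ℝⁿ` with the Euclidean norm. -/
abbrev RSpace (n : ℕ) : Type := EuclideanSpace ℝ (Fin n)

/-- `ℂⁿ` with the Hermitian norm. -/
abbrev CSpace (n : ℕ) : Type := EuclideanSpace ℂ (Fin n)

variable {n : ℕ}

/-- The symmetric bilinear (not sesquilinear) dot product `a · b = ∑ aᵢ bᵢ` on `ℂⁿ`. -/
def dot (a b : CSpace n) : ℂ := ∑ i, a i * b i

/-- The inclusion `ℝⁿ ⊆ ℂⁿ`. -/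
def toC (a : RSpace n) : CSpace n := WithLp.toLp 2 fun i => (a i : ℂ)

/-- On real vectors, `a · a` is the squared Euclidean norm. -/
theorem dot_self_of_real (a : CSpace n) (ha : ∀ i, (a i).im = 0) :
    dot a a = ((‖a‖ ^ 2 : ℝ) : ℂ) := by
  rw [EuclideanSpace.norm_sq_eq, dot, Complex.ofReal_sum]
  refine Finset.sum_congr rfl fun i _ => ?_
  have h : a i = ((a i).re : ℂ) := Complex.ext rfl (by simpa using ha i)
  rw [h, ← Complex.ofReal_mul, Complex.norm_real, Real.norm_eq_abs, sq_abs, sq]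

/-! ### Parts of bivariate vector functions -/

/-- The symmetric part `A_s(x,y) = (A(x,y) + A(y,x)) / 2`. -/
def symPart (A : RSpace n × RSpace n → CSpace n) : RSpace n × RSpace n → CSpace n :=
  fun z => (1 / 2 : ℂ) • (A z + A z.swap)

/-- The antisymmetric part `A_a = A - A_s`. -/
def antiPart (A : RSpace n × RSpace n → CSpace n) : RSpace n × RSpace n → CSpace n :=
  fun z => A z - symPart A z

open Classical in
/-- The parallel part: the projection of `A(x,y)` on `x - y` if `x ≠ y`, and `A(x,y)` if `x = y`. -/
def parPart (A : RSpace n × RSpace n → CSpace n) : RSpace n × RSpace n → CSpace n :=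
  fun z => if z.1 = z.2 then A z else
    (dot (A z) (toC (z.1 - z.2)) / ((‖z.1 - z.2‖ ^ 2 : ℝ) : ℂ)) • toC (z.1 - z.2)

/-- `𝒥₁A(x) = (∫ |A(y,x)|² dy)^{1/2}`, with values in `[0,∞]`. -/
def J1 (A : RSpace n × RSpace n → CSpace n) (x : RSpace n) : ℝ≥0∞ :=
  (∫⁻ y, ‖A (y, x)‖ₑ ^ 2) ^ (1 / 2 : ℝ)

/-- `𝒥₂A(x) = (∫ |A(x,y)|² dy)^{1/2}`, with values in `[0,∞]`. -/
def J2 (A : RSpace n × RSpace n → CSpace n) (x : RSpace n) : ℝ≥0∞ :=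
  (∫⁻ y, ‖A (x, y)‖ₑ ^ 2) ^ (1 / 2 : ℝ)

/-! ### Sobolev spaces of nonnegative order -/

/-- `f ∈ H^t`, for `t ≥ 0`: `f` is an `L²` function with `⟨ξ⟩^t f̂ ∈ L²`. -/
def MemH {V F : Type*} [NormedAddCommGroup V] [InnerProductSpace ℝ V] [FiniteDimensional ℝ V]
    [MeasurableSpace V] [BorelSpace V] [NormedAddCommGroup F] [InnerProductSpace ℂ F]
    [CompleteSpace F] (t : ℝ) (f : V → F) : Prop :=
  ∃ hf : MemLp f 2 (volume : Measure V),
    TemperedDistribution.MemSobolev t 2 ((hf.toLp f : Lp F 2 (volume : Measure V)) : 𝓢'(V, F))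

/-! ### Fractional gradient and divergence -/

/-- The constant `𝒞_{n,s} = 4^s Γ(n/2+s) / (π^{n/2} |Γ(-s)|)` in the singular integral
representation of the fractional Laplacian with Fourier symbol `|ξ|^{2s}`. -/
def fracConst (n : ℕ) (s : ℝ) : ℝ :=
  (4 : ℝ) ^ s * Real.Gamma ((n : ℝ) / 2 + s) /
    (Real.pi ^ ((n : ℝ) / 2) * |Real.Gamma (-s)|)

/-- `α(x,y) = 𝒞_{n,s}^{1/2} / √2 · (y - x) / |y - x|^{n/2+s+1}`. -/
def alpha (s : ℝ) (z : RSpace n × RSpace n) : CSpace n :=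
  toC ((Real.sqrt (fracConst n s) / Real.sqrt 2 /
    ‖z.2 - z.1‖ ^ ((n : ℝ) / 2 + s + 1)) • (z.2 - z.1))

/-- The fractional gradient `∇ˢu(x,y) = (u(x) - u(y)) α(x,y)`. -/
def fracGrad (s : ℝ) (u : RSpace n → ℂ) : RSpace n × RSpace n → CSpace n :=
  fun z => (u z.1 - u z.2) • alpha s z

/-- The fractional divergence of `w ∈ L²(ℝ²ⁿ)`, as the functional
`u ↦ ⟨w, ∇ˢu⟩` dual to the fractional gradient. -/
def fracDiv (s : ℝ) (w : RSpace n × RSpace n → CSpace n) (u : RSpace n → ℂ) : ℂ :=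
  ∫ z, dot (w z) (fracGrad s u z)

/-! ### Potentials -/

/-- The exponent `p = max {2, n/(2s)}`. -/
def expo (n : ℕ) (s : ℝ) : ℝ := max 2 ((n : ℝ) / (2 * s))

/-- The class `𝒫₀` of pairs of potentials. A scalar potential in `L^p(Ω)` is a function on `ℝⁿ`
vanishing outside `Ω`. -/
structure MemP0 (s : ℝ) (Ω : Set (RSpace n)) (A : RSpace n × RSpace n → CSpace n)
    (q : RSpace n → ℝ) : Prop where
  meas : AEStronglyMeasurable A
  J1_mem : ∫⁻ x, J1 A x ^ (2 * expo n s) < ⊤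
  J2_mem : ∫⁻ x, J2 A x ^ (2 * expo n s) < ⊤
  sym_mem : MemH (s * expo n s - s)
    fun z : WithLp 2 (RSpace n × RSpace n) => parPart (symPart A) (WithLp.ofLp z)
  anti_nonneg : ∀ᵐ z : RSpace n × RSpace n,
    0 ≤ (dot (parPart (antiPart A) z) (toC (z.2 - z.1))).re ∧
      (dot (parPart (antiPart A) z) (toC (z.2 - z.1))).im = 0
  q_mem : MemLp q (ENNReal.ofReal (expo n s)) (volume.restrict Ω)
  q_zero : ∀ᵐ x ∂(volume.restrict Ωᶜ), q x = 0

/-! ### The magnetic operators -/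

/-- The magnetic fractional gradient `∇ˢ_A u(x,y) = ∇ˢu(x,y) + A(x,y) u(x)`. -/
def magGrad (s : ℝ) (A : RSpace n × RSpace n → CSpace n) (u : RSpace n → ℂ) :
    RSpace n × RSpace n → CSpace n :=
  fun z => fracGrad s u z + u z.1 • A z

/-- The magnetic fractional Laplacian: `(-Δ)ˢ_A u` is the functional `v ↦ ⟨∇ˢ_A u, ∇ˢ_A v⟩`
on `Hˢ`. -/
def magLaplacian (s : ℝ) (A : RSpace n × RSpace n → CSpace n) (u v : RSpace n → ℂ) : ℂ :=
  ∫ z, dot (magGrad s A u z) (magGrad s A v z)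

/-- `(-Δ)ˢ_A u + q u`, as a functional of `v ∈ Hˢ`. -/
def magSchrodinger (s : ℝ) (A : RSpace n × RSpace n → CSpace n) (q : RSpace n → ℝ)
    (u v : RSpace n → ℂ) : ℂ :=
  magLaplacian s A u v + ∫ x, (q x : ℂ) * u x * v x

/-- The gauge `(A,q) ∼ (A',q')`: `(-Δ)ˢ_A u + q u = (-Δ)ˢ_{A'} u + q' u` in `H⁻ˢ`
for all `u ∈ Hˢ`. -/
def GaugeEquiv (s : ℝ) (A : RSpace n × RSpace n → CSpace n) (q : RSpace n → ℝ)
    (A' : RSpace n × RSpace n → CSpace n) (q' : RSpace n → ℝ) : Prop :=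
  ∀ u : RSpace n → ℂ, MemH s u → ∀ v : RSpace n → ℂ, MemH s v →
    magSchrodinger s A q u v = magSchrodinger s A' q' u v

/-- The distribution `Q = q + ∫ A·A dy + (∇·)ˢ A_{s∥}` applied to a test function `φ`.
The zeroth order term that the bilinear pairing produces is `A·A = ∑ Aᵢ²`, that is `|A|²`
for real `A`. -/
def Q (s : ℝ) (A : RSpace n × RSpace n → CSpace n) (q : RSpace n → ℝ) (φ : RSpace n → ℂ) : ℂ :=
  (∫ x, ((q x : ℂ) + ∫ y, dot (A (x, y)) (A (x, y))) * φ x) +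
    fracDiv s (parPart (symPart A)) φ

end FracMag

end

/-! Write α for `alpha`. The cross terms of ⟨∇ˢ_A u, ∇ˢ_A v⟩ carry the weight u(x)(v(x) − v(y)) +
v(x)(u(x) − u(y)), which equals (u(x) − u(y))(v(x) − v(y)) + (u(x)v(x) − u(y)v(y)). The first
summand is invariant under exchange of x and y, the second changes sign, and so does α. Hence the
first sees only the antisymmetric part of A and the second only the symmetric part. Together with q
and A·A the second assembles into Q tested on the product uv, so the Schrödinger form is ⟨∇ˢu, ∇ˢv⟩
+ `antiForm`(u,v) + Q(uv) (`MemP0.magSchrodinger_eq`). Since α is parallel to x − y, only parallel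
parts matter.

Equality of the data therefore gives equality of the forms, once equality of Q and Q' on test
functions is extended to products of Hˢ functions by density (`Q_mul_eq_of_forall_contDiff`).
Conversely, test functions with uv = 0 eliminate Q. For them (u(x) − u(y))(v(x) − v(y)) = −(u(x)v(y)
+ u(y)v(x)), so the symmetric kernel (A_a − A'_a)·α annihilates products of functions living on
disjoint sets and vanishes almost everywhere off the diagonal (`ae_eq_zero_of_diff_mul_diff`). With
the antisymmetric forms equal, choosing v = 1 on the support of u yields Q = Q' (`GaugeEquiv.Q_eq`).

The analysis consists in making every term a pairing of L² functions. The embedding of Hˢ into L^r,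
r = 2p/(p − 1), and Hölder's inequality show that A multiplies Hˢ into L²(ℝ²ⁿ) and √|q| multiplies
it into L²(ℝⁿ). Both the embedding and the Gagliardo bound are proved for Schwartz functions by
Fourier analysis and carried to Hˢ by Fatou's lemma. -/

noncomputable section

namespace FracMag

/-! ### Radial power integrals and their scaling -/

section Radial

variable {E : Type*} [NormedAddCommGroup E] [NormedSpace ℝ E] [MeasurableSpace E] [BorelSpace E]
  [FiniteDimensional ℝ E] (μ : Measure E) [μ.IsAddHaarMeasure]

theorem lintegral_comp_smul_addHaar (f : E → ℝ≥0∞) {R : ℝ} (hR : 0 < R) :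
    ∫⁻ x, f (R • x) ∂μ = ENNReal.ofReal ((R ^ Module.finrank ℝ E)⁻¹) * ∫⁻ x, f x ∂μ := by
  have h := (Homeomorph.smulOfNeZero R hR.ne' : E ≃ₜ E).measurableEmbedding.lintegral_map
    (μ := μ) f
  have h2 : Measure.map (Homeomorph.smulOfNeZero R hR.ne' : E ≃ₜ E) μ =
      ENNReal.ofReal |(R ^ Module.finrank ℝ E)⁻¹| • μ := Measure.map_addHaar_smul μ hR.ne'
  rw [h2, lintegral_smul_measure, abs_of_pos (by positivity)] at h
  exact h.symm

theorem lintegral_ball_norm_rpow {a R : ℝ} (hR : 0 < R) :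
    ∫⁻ x in Metric.ball (0 : E) R, ENNReal.ofReal (‖x‖ ^ (-a)) ∂μ =
      ENNReal.ofReal (R ^ ((Module.finrank ℝ E : ℝ) - a)) *
        ∫⁻ x in Metric.ball (0 : E) 1, ENNReal.ofReal (‖x‖ ^ (-a)) ∂μ := by
  rw [← lintegral_indicator measurableSet_ball, ← lintegral_indicator measurableSet_ball]
  have h := lintegral_comp_smul_addHaar μ
    ((Metric.ball (0 : E) R).indicator fun x => ENNReal.ofReal (‖x‖ ^ (-a))) hR
  have h2 : ∀ x : E, (Metric.ball (0 : E) R).indicator (fun x => ENNReal.ofReal (‖x‖ ^ (-a)))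
      (R • x) = ENNReal.ofReal (R ^ (-a)) *
        (Metric.ball (0 : E) 1).indicator (fun x => ENNReal.ofReal (‖x‖ ^ (-a))) x := by
    intro x
    have hx : R • x ∈ Metric.ball (0 : E) R ↔ x ∈ Metric.ball (0 : E) 1 := by
      simp [norm_smul, abs_of_pos hR, hR]
    by_cases h1 : x ∈ Metric.ball (0 : E) 1
    · rw [Set.indicator_of_mem (hx.2 h1), Set.indicator_of_mem h1, norm_smul, Real.norm_eq_abs,
        abs_of_pos hR, Real.mul_rpow hR.le (norm_nonneg _), ENNReal.ofReal_mul (by positivity)]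
    · rw [Set.indicator_of_notMem (mt hx.1 h1), Set.indicator_of_notMem h1, mul_zero]
  simp_rw [h2] at h
  rw [lintegral_const_mul' _ _ ENNReal.ofReal_ne_top] at h
  have h3 : ENNReal.ofReal (R ^ Module.finrank ℝ E) * ENNReal.ofReal ((R ^ Module.finrank ℝ E)⁻¹)
      = 1 := by
    rw [← ENNReal.ofReal_mul (by positivity), mul_inv_cancel₀ (by positivity), ENNReal.ofReal_one]
  rw [← one_mul (lintegral μ _), ← h3, mul_assoc, ← h, ← mul_assoc,
    ← ENNReal.ofReal_mul (by positivity), ← Real.rpow_natCast, ← Real.rpow_add hR, sub_eq_add_neg]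

variable [Nontrivial E]

theorem lintegral_ball_norm_rpow_lt_top {a : ℝ} (ha : a < Module.finrank ℝ E) :
    ∫⁻ x in Metric.ball (0 : E) 1, ENNReal.ofReal (‖x‖ ^ (-a)) ∂μ < ⊤ := by
  have hd : 1 ≤ Module.finrank ℝ E := Module.finrank_pos
  have h : IntegrableOn (fun x : E => ‖x‖ ^ (-a)) (Metric.ball (0 : E) 1) μ := by
    rw [integrableOn_fun_norm_addHaar μ (f := fun y : ℝ => y ^ (-a))]
    have h2 : IntegrableOn (fun y : ℝ => y ^ ((Module.finrank ℝ E : ℝ) - 1 - a)) (Set.Ioo 0 1) :=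
      (intervalIntegral.integrableOn_Ioo_rpow_iff one_pos).2 (by linarith)
    refine h2.congr_fun (fun y hy => ?_) measurableSet_Ioo
    simp only [smul_eq_mul]
    rw [← Real.rpow_natCast, ← Real.rpow_add hy.1, Nat.cast_sub hd]
    congr 1
    push_cast
    ring
  exact h.lintegral_lt_top

/-- Convergence at the origin comes from s < 1, at infinity from s > 0. The truncated square stands
in for |1 − e^{i⟨h,ξ⟩}|² in the Gagliardo seminorm. -/
theorem lintegral_min_norm_rpow_lt_top {s : ℝ} (hs : s ∈ Set.Ioo (0 : ℝ) 1) :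
    ∫⁻ x : E, ENNReal.ofReal
      (min 1 (‖x‖ ^ 2) * ‖x‖ ^ (-((Module.finrank ℝ E : ℝ) + 2 * s))) ∂μ < ⊤ := by
  obtain ⟨hs0, hs1⟩ := hs
  have hd : 1 ≤ Module.finrank ℝ E := Module.finrank_pos
  have key : ∀ y : ℝ, 0 < y → ∀ b : ℝ, y ^ (Module.finrank ℝ E - 1) *
      (y ^ b * y ^ (-((Module.finrank ℝ E : ℝ) + 2 * s))) = y ^ (b - 1 - 2 * s) := by
    intro y hy b
    rw [← Real.rpow_natCast, ← Real.rpow_add hy, ← Real.rpow_add hy, Nat.cast_sub hd]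
    congr 1
    push_cast
    ring
  have h : Integrable (fun x : E => min 1 (‖x‖ ^ 2) *
      ‖x‖ ^ (-((Module.finrank ℝ E : ℝ) + 2 * s))) μ := by
    rw [integrable_fun_norm_addHaar μ
      (f := fun y : ℝ => min 1 (y ^ 2) * y ^ (-((Module.finrank ℝ E : ℝ) + 2 * s))),
      ← Set.Ioc_union_Ioi_eq_Ioi zero_le_one]
    refine IntegrableOn.union ?_ ?_
    · have h2 : IntegrableOn (fun y : ℝ => y ^ (2 - 1 - 2 * s)) (Set.Ioc 0 1) := by
        rw [integrableOn_Ioc_iff_integrableOn_Ioo]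
        exact (intervalIntegral.integrableOn_Ioo_rpow_iff one_pos).2 (by linarith)
      refine h2.congr_fun (fun y hy => ?_) measurableSet_Ioc
      simp only [smul_eq_mul]
      rw [min_eq_right (pow_le_one₀ hy.1.le hy.2), ← key y hy.1]
      norm_num
    · have h2 : IntegrableOn (fun y : ℝ => y ^ (0 - 1 - 2 * s)) (Set.Ioi 1) :=
        integrableOn_Ioi_rpow_of_lt (by linarith) one_pos
      refine h2.congr_fun (fun y hy => ?_) measurableSet_Ioi
      have hy1 : (1 : ℝ) < y := hy
      simp only [smul_eq_mul]
      rw [min_eq_left (one_le_pow₀ hy1.le), ← key y (by linarith)]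
      norm_num
  exact h.lintegral_lt_top

/-- Dilation by r; with r proportional to |ξ| this produces the multiplier |ξ|^{2s}. -/
theorem lintegral_min_mul_norm_rpow {s r : ℝ} (hs : 0 < s) (hr : 0 ≤ r) :
    ∫⁻ x : E, ENNReal.ofReal
      (min 1 ((r * ‖x‖) ^ 2) * ‖x‖ ^ (-((Module.finrank ℝ E : ℝ) + 2 * s))) ∂μ =
    ENNReal.ofReal (r ^ (2 * s)) * ∫⁻ x : E, ENNReal.ofReal
      (min 1 (‖x‖ ^ 2) * ‖x‖ ^ (-((Module.finrank ℝ E : ℝ) + 2 * s))) ∂μ := by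
  rcases hr.eq_or_lt with rfl | hr
  · simp [Real.zero_rpow (by positivity : 2 * s ≠ 0)]
  have h := lintegral_comp_smul_addHaar μ (fun x : E => ENNReal.ofReal
      (min 1 (‖x‖ ^ 2) * ‖x‖ ^ (-((Module.finrank ℝ E : ℝ) + 2 * s)))) hr
  have h2 : ∀ x : E, ENNReal.ofReal
      (min 1 (‖r • x‖ ^ 2) * ‖r • x‖ ^ (-((Module.finrank ℝ E : ℝ) + 2 * s))) =
      ENNReal.ofReal (r ^ (-((Module.finrank ℝ E : ℝ) + 2 * s))) * ENNReal.ofReal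
      (min 1 ((r * ‖x‖) ^ 2) * ‖x‖ ^ (-((Module.finrank ℝ E : ℝ) + 2 * s))) := by
    intro x
    rw [norm_smul, Real.norm_eq_abs, abs_of_pos hr, Real.mul_rpow hr.le (norm_nonneg _),
      ← ENNReal.ofReal_mul (by positivity)]
    congr 1
    ring
  simp_rw [h2] at h
  rw [lintegral_const_mul' _ _ ENNReal.ofReal_ne_top] at h
  have h3 : ENNReal.ofReal (r ^ ((Module.finrank ℝ E : ℝ) + 2 * s)) *
      ENNReal.ofReal (r ^ (-((Module.finrank ℝ E : ℝ) + 2 * s))) = 1 := by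
    rw [← ENNReal.ofReal_mul (by positivity), ← Real.rpow_add hr]
    simp
  rw [← one_mul (lintegral μ _), ← h3, mul_assoc, h, ← mul_assoc,
    ← ENNReal.ofReal_mul (by positivity), ← Real.rpow_natCast, ← Real.rpow_neg hr.le,
    ← Real.rpow_add hr]
  congr 3
  ring

end Radial

/-! ### Plancherel and frequency splitting for Schwartz functions -/

section SchwartzFourier

open FourierTransform

variable {E : Type*} [NormedAddCommGroup E] [InnerProductSpace ℝ E] [MeasurableSpace E]
  [BorelSpace E] [FiniteDimensional ℝ E]

theorem eLpNorm_two_sq {α F : Type*} [MeasurableSpace α] {μ : Measure α} [NormedAddCommGroup F]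
    (f : α → F) : eLpNorm f 2 μ ^ 2 = ∫⁻ x, ‖f x‖ₑ ^ 2 ∂μ := by
  rw [eLpNorm_eq_lintegral_rpow_enorm_toReal (by norm_num) (by norm_num)]
  simp only [ENNReal.toReal_ofNat, ENNReal.rpow_ofNat]
  rw [← ENNReal.rpow_natCast, ← ENNReal.rpow_mul]
  norm_num

theorem eLpNorm_fourier_eq (f : 𝓢(E, ℂ)) :
    eLpNorm (𝓕 f : 𝓢(E, ℂ)) 2 volume = eLpNorm f 2 volume := by
  have h := SchwartzMap.norm_fourier_toL2_eq f
  rw [SchwartzMap.norm_toLp, SchwartzMap.norm_toLp] at h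
  exact (ENNReal.toReal_eq_toReal_iff' 
    (SchwartzMap.eLpNorm_lt_top (𝓕 f : 𝓢(E, ℂ)) 2 volume).ne
    (SchwartzMap.eLpNorm_lt_top f 2 volume).ne).1 h

theorem lintegral_fourier_sq (f : 𝓢(E, ℂ)) :
    ∫⁻ ξ, ‖(𝓕 f : 𝓢(E, ℂ)) ξ‖ₑ ^ 2 = ∫⁻ x, ‖f x‖ₑ ^ 2 := by
  rw [← eLpNorm_two_sq, ← eLpNorm_two_sq, eLpNorm_fourier_eq]

theorem enorm_le_lintegral_fourier (f : 𝓢(E, ℂ)) (x : E) :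
    ‖f x‖ₑ ≤ ∫⁻ ξ, ‖(𝓕 f : 𝓢(E, ℂ)) ξ‖ₑ := by
  have h : f x = (𝓕⁻ (𝓕 f) : 𝓢(E, ℂ)) x := by rw [FourierTransform.fourierInv_fourier_eq]
  rw [h, SchwartzMap.fourierInv_coe, Real.fourierInv_eq]
  refine (enorm_integral_le_lintegral_enorm _).trans (lintegral_mono fun ξ => ?_)
  rw [← ofReal_norm, ← ofReal_norm, Circle.norm_smul]

/-- The distribution function of a Schwartz function is controlled by its high frequencies. -/
theorem volume_lt_norm_le [Nontrivial E] {σ c m R t : ℝ} (hc : 0 ≤ c) (hm : 0 ≤ m)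
    (hR : 0 < R) (ht : 0 < t)
    (hball : ∫⁻ ξ in Metric.ball (0 : E) 1, ENNReal.ofReal (‖ξ‖ ^ (-(2 * σ))) ≤
      ENNReal.ofReal (c ^ 2))
    (hle : c * (2 * R) ^ ((Module.finrank ℝ E : ℝ) / 2 - σ) * m ≤ t / 2) (f : 𝓢(E, ℂ))
    (hf : ∫⁻ ξ, ENNReal.ofReal (‖ξ‖ ^ (2 * σ)) * ‖(𝓕 f : 𝓢(E, ℂ)) ξ‖ₑ ^ 2 ≤
      ENNReal.ofReal (m ^ 2)) :
    volume {x | t < ‖f x‖} ≤ ENNReal.ofReal (4 / t ^ 2) *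
      ∫⁻ ξ in {ξ : E | R ≤ ‖ξ‖}, ‖(𝓕 f : 𝓢(E, ℂ)) ξ‖ₑ ^ 2 := by
  -- Split f at frequency R. By Cauchy–Schwarz against the weight |ξ|^σ on the ball of radius 2R,
  -- `hle` bounds the low part by t/2 everywhere. Where |f| > t the high part thus exceeds t/2, and
  -- Chebyshev with Plancherel finishes.
  let χ : ContDiffBump (0 : E) := ⟨R, 2 * R, hR, by linarith⟩
  have hχ : (fun ξ => ((χ ξ : ℝ) : ℂ)).HasTemperateGrowth := by
    refine HasCompactSupport.hasTemperateGrowth ?_ ?_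
    · exact χ.hasCompactSupport.comp_left (g := fun r : ℝ => (r : ℂ)) Complex.ofReal_zero
    · exact Complex.ofRealCLM.contDiff.comp χ.contDiff
  let lo : 𝓢(E, ℂ) := SchwartzMap.smulLeftCLM ℂ (fun ξ => ((χ ξ : ℝ) : ℂ)) (𝓕 f)
  have hlo : ∀ ξ, lo ξ = ((χ ξ : ℝ) : ℂ) * (𝓕 f : 𝓢(E, ℂ)) ξ := fun ξ => by
    simp [lo, SchwartzMap.smulLeftCLM_apply_apply hχ]
  have hsplit : f = 𝓕⁻ lo + 𝓕⁻ (𝓕 f - lo) := by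
    rw [← FourierTransform.fourierInv_add]
    simp
  have hlow : ∀ x, ‖(𝓕⁻ lo : 𝓢(E, ℂ)) x‖ₑ ≤ ENNReal.ofReal (t / 2) := by
    intro x
    refine (enorm_le_lintegral_fourier _ x).trans ?_
    rw [FourierTransform.fourier_fourierInv_eq]
    have h1 : ∀ ξ ∉ Metric.ball (0 : E) (2 * R), ‖lo ξ‖ₑ = 0 := by
      intro ξ hξ
      have : χ ξ = 0 := χ.zero_of_le_dist (by simpa using hξ)
      simp [hlo, this]
    have h2 : ∀ ξ, ‖lo ξ‖ₑ ≤ ‖(𝓕 f : 𝓢(E, ℂ)) ξ‖ₑ := by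
      intro ξ
      rw [hlo, enorm_mul]
      refine mul_le_of_le_one_left zero_le ?_
      rw [← ofReal_norm, Complex.norm_real, Real.norm_of_nonneg χ.nonneg]
      exact ENNReal.ofReal_le_one.2 χ.le_one
    calc ∫⁻ ξ, ‖lo ξ‖ₑ = ∫⁻ ξ in Metric.ball (0 : E) (2 * R), ‖lo ξ‖ₑ := by
          refine (setLIntegral_eq_of_support_subset ?_).symm
          intro ξ hξ
          by_contra h
          exact hξ (h1 ξ h)
      _ ≤ ∫⁻ ξ in Metric.ball (0 : E) (2 * R),
          (ENNReal.ofReal (‖ξ‖ ^ (-σ)) * (ENNReal.ofReal (‖ξ‖ ^ σ) * ‖(𝓕 f : 𝓢(E, ℂ)) ξ‖ₑ)) := by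
          have h0 : ∀ᵐ ξ : E, ξ ≠ 0 := by
            simp [ae_iff]
          refine lintegral_mono_ae ((ae_restrict_of_ae h0).mono fun ξ hξ => ?_)
          rw [← mul_assoc, ← ENNReal.ofReal_mul (by positivity),
            ← Real.rpow_add (norm_pos_iff.2 hξ), neg_add_cancel, Real.rpow_zero,
            ENNReal.ofReal_one, one_mul]
          exact h2 ξ
      _ ≤ (∫⁻ ξ in Metric.ball (0 : E) (2 * R),
            ENNReal.ofReal (‖ξ‖ ^ (-σ)) ^ (2 : ℝ)) ^ (1 / 2 : ℝ) *
          (∫⁻ ξ in Metric.ball (0 : E) (2 * R),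
            (ENNReal.ofReal (‖ξ‖ ^ σ) * ‖(𝓕 f : 𝓢(E, ℂ)) ξ‖ₑ) ^ (2 : ℝ)) ^ (1 / 2 : ℝ) := by
          refine ENNReal.lintegral_mul_le_Lp_mul_Lq _ Real.HolderConjugate.two_two ?_ ?_
          · fun_prop
          · have := (𝓕 f).continuous
            fun_prop
      _ ≤ (ENNReal.ofReal ((2 * R) ^ ((Module.finrank ℝ E : ℝ) - 2 * σ)) *
            ENNReal.ofReal (c ^ 2)) ^ (1 / 2 : ℝ) * (ENNReal.ofReal (m ^ 2)) ^ (1 / 2 : ℝ) := by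
          gcongr
          · refine le_trans (le_of_eq ?_) (mul_le_mul_right hball _)
            rw [← lintegral_ball_norm_rpow volume (by positivity)]
            refine lintegral_congr fun ξ => ?_
            rw [ENNReal.ofReal_rpow_of_nonneg (by positivity) (by norm_num),
              ← Real.rpow_mul (by positivity)]
            congr 2
            ring
          · refine (setLIntegral_le_lintegral _ _).trans (le_trans (le_of_eq ?_) hf)
            refine lintegral_congr fun ξ => ?_
            rw [ENNReal.mul_rpow_of_nonneg _ _ (by norm_num),
              ENNReal.ofReal_rpow_of_nonneg (by positivity) (by norm_num),
              ← Real.rpow_mul (by positivity), ENNReal.rpow_ofNat]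
            congr 3
            ring
      _ ≤ ENNReal.ofReal (t / 2) := by
          rw [← ENNReal.mul_rpow_of_nonneg _ _ (by norm_num), ← ENNReal.ofReal_mul (by positivity),
            ← ENNReal.ofReal_mul (by positivity),
            ENNReal.ofReal_rpow_of_nonneg (by positivity) (by norm_num)]
          refine ENNReal.ofReal_le_ofReal (le_trans (le_of_eq ?_) hle)
          rw [Real.mul_rpow (by positivity) (by positivity),
            Real.mul_rpow (by positivity) (by positivity), ← Real.rpow_mul (by positivity),
            ← Real.sqrt_eq_rpow, ← Real.sqrt_eq_rpow, Real.sqrt_sq hc, Real.sqrt_sq hm,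
            mul_comm _ c]
          congr 3
          ring
  have hsub : {x | t < ‖f x‖} ⊆ {x | ENNReal.ofReal ((t / 2) ^ 2) ≤
      ‖(𝓕⁻ (𝓕 f - lo) : 𝓢(E, ℂ)) x‖ₑ ^ 2} := by
    intro x hx
    simp only [Set.mem_ofPred_eq] at hx ⊢
    have h1 : ‖(𝓕⁻ lo : 𝓢(E, ℂ)) x‖ ≤ t / 2 := by
      have := hlow x
      rwa [← ofReal_norm, ENNReal.ofReal_le_ofReal_iff (by positivity)] at this
    have h2 : f x = (𝓕⁻ lo : 𝓢(E, ℂ)) x + (𝓕⁻ (𝓕 f - lo) : 𝓢(E, ℂ)) x := by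
      conv_lhs => rw [hsplit]
      rfl
    have h3 := norm_add_le ((𝓕⁻ lo : 𝓢(E, ℂ)) x) ((𝓕⁻ (𝓕 f - lo) : 𝓢(E, ℂ)) x)
    rw [← h2] at h3
    rw [← ofReal_norm, ← ENNReal.ofReal_pow (norm_nonneg _)]
    refine ENNReal.ofReal_le_ofReal (pow_le_pow_left₀ (by positivity) (by linarith) 2)
  have hcheb := mul_meas_ge_le_lintegral₀ (μ := (volume : Measure E))
    (f := fun x => ‖(𝓕⁻ (𝓕 f - lo) : 𝓢(E, ℂ)) x‖ₑ ^ 2)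
    (by have := (𝓕⁻ (𝓕 f - lo) : 𝓢(E, ℂ)).continuous; fun_prop) (ENNReal.ofReal ((t / 2) ^ 2))
  rw [← lintegral_fourier_sq, FourierTransform.fourier_fourierInv_eq] at hcheb
  have hhigh : ∫⁻ ξ, ‖(𝓕 f - lo : 𝓢(E, ℂ)) ξ‖ₑ ^ 2 ≤
      ∫⁻ ξ in {ξ : E | R ≤ ‖ξ‖}, ‖(𝓕 f : 𝓢(E, ℂ)) ξ‖ₑ ^ 2 := by
    rw [← lintegral_indicator (measurableSet_le measurable_const measurable_norm)]
    refine lintegral_mono fun ξ => ?_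
    have h0 : (𝓕 f - lo : 𝓢(E, ℂ)) ξ = ((1 - χ ξ : ℝ) : ℂ) * (𝓕 f : 𝓢(E, ℂ)) ξ := by
      rw [sub_apply, hlo]
      push_cast
      ring
    rw [h0]
    by_cases h : R ≤ ‖ξ‖
    · rw [Set.indicator_of_mem (by exact h), enorm_mul]
      gcongr
      refine mul_le_of_le_one_left zero_le ?_
      rw [← ofReal_norm, Complex.norm_real, Real.norm_of_nonneg (by linarith [χ.le_one (x := ξ)])]
      exact ENNReal.ofReal_le_one.2 (by linarith [χ.nonneg (x := ξ)])
    · have : χ ξ = 1 := χ.one_of_mem_closedBall (by simpa using (not_le.1 h).le)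
      simp [this]
  calc volume {x | t < ‖f x‖} ≤ _ := measure_mono hsub
    _ = ENNReal.ofReal (4 / t ^ 2) * (ENNReal.ofReal ((t / 2) ^ 2) * _) := by
        rw [← mul_assoc, ← ENNReal.ofReal_mul (by positivity)]
        have : 4 / t ^ 2 * (t / 2) ^ 2 = 1 := by field_simp; norm_num
        rw [this, ENNReal.ofReal_one, one_mul]
    _ ≤ _ := mul_le_mul_right (hcheb.trans hhigh) _

end SchwartzFourier

/-! ### Sobolev inequality and Gagliardo seminorm for Schwartz functions -/

section SchwartzSobolev

open FourierTransform

variable {E : Type*} [NormedAddCommGroup E] [InnerProductSpace ℝ E] [MeasurableSpace E]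
  [BorelSpace E] [FiniteDimensional ℝ E]

theorem lintegral_Ioc_rpow {a T : ℝ} (ha : -1 < a) (hT : 0 ≤ T) :
    ∫⁻ t in Set.Ioc 0 T, ENNReal.ofReal (t ^ a) = ENNReal.ofReal (T ^ (a + 1) / (a + 1)) := by
  have h := intervalIntegral.intervalIntegrable_rpow' (a := 0) (b := T) ha
  rw [intervalIntegrable_iff_integrableOn_Ioc_of_le hT] at h
  rw [← ofReal_integral_eq_lintegral_ofReal h, ← intervalIntegral.integral_of_le hT,
    integral_rpow (Or.inl ha), Real.zero_rpow (by linarith), sub_zero]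
  exact (ae_restrict_mem measurableSet_Ioc).mono fun t ht => Real.rpow_nonneg ht.1.le _

theorem fourier_compSubConst_apply (f : 𝓢(E, ℂ)) (h ξ : E) :
    (𝓕 (SchwartzMap.compSubConstCLM ℂ (-h) f) : 𝓢(E, ℂ)) ξ =
      ((Real.fourierChar (inner ℝ h ξ) : Circle) : ℂ) * (𝓕 f : 𝓢(E, ℂ)) ξ := by
  have h1 := congrFun (VectorFourier.fourierIntegral_comp_add_right Real.fourierChar volume
    (innerₗ E) f h) ξ
  rw [SchwartzMap.fourier_coe, SchwartzMap.fourier_coe]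
  have h2 : (SchwartzMap.compSubConstCLM ℂ (-h) f : E → ℂ) = f ∘ fun v => v + h := by
    ext x
    simp
  rw [h2]
  exact h1

variable [Nontrivial E]

/-- The Sobolev inequality at the critical exponent, for Schwartz functions. -/
theorem lintegral_rpow_le_of_schwartz {σ : ℝ} (hσ : 0 < σ)
    (hσd : 2 * σ < Module.finrank ℝ E) {q : ℝ}
    (hq : q = 2 * Module.finrank ℝ E / (Module.finrank ℝ E - 2 * σ)) :
    ∃ C : ℝ≥0∞, C ≠ ⊤ ∧ ∀ (f : 𝓢(E, ℂ)) (m : ℝ), 0 < m →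
      ∫⁻ ξ, ENNReal.ofReal (‖ξ‖ ^ (2 * σ)) * ‖(𝓕 f : 𝓢(E, ℂ)) ξ‖ₑ ^ 2 ≤ ENNReal.ofReal (m ^ 2) →
      ∫⁻ x, ENNReal.ofReal (‖f x‖ ^ q) ≤ C * ENNReal.ofReal (m ^ q) := by
  set d : ℝ := (Module.finrank ℝ E : ℝ) with hd
  have hI := lintegral_ball_norm_rpow_lt_top (volume : Measure E) hσd
  obtain ⟨c, hc, hball⟩ : ∃ c : ℝ, 0 < c ∧
      ∫⁻ ξ in Metric.ball (0 : E) 1, ENNReal.ofReal (‖ξ‖ ^ (-(2 * σ))) ≤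
        ENNReal.ofReal (c ^ 2) := by
    set I := ∫⁻ ξ in Metric.ball (0 : E) 1, ENNReal.ofReal (‖ξ‖ ^ (-(2 * σ)))
    refine ⟨I.toReal + 1, by positivity, ?_⟩
    rw [← ENNReal.ofReal_toReal hI.ne]
    refine ENNReal.ofReal_le_ofReal ?_
    rw [ENNReal.toReal_ofReal ENNReal.toReal_nonneg]
    nlinarith [ENNReal.toReal_nonneg (a := I)]
  set β : ℝ := d / 2 - σ with hβ
  have hβ0 : 0 < β := by simp only [hβ]; linarith
  -- Criticality of q: the integral over the levels below will give the power |ξ|^{β(q − 2)}, which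
  -- has to be |ξ|^{2σ}.
  have hq2 : q - 2 = 2 * σ / β := by
    have : d - 2 * σ ≠ 0 := by linarith
    have : β = (d - 2 * σ) / 2 := by simp only [hβ]; ring
    rw [hq, this]
    field_simp
    ring
  have hq2' : 0 < q - 2 := by rw [hq2]; positivity
  refine ⟨ENNReal.ofReal q * ENNReal.ofReal (4 / (q - 2) * (2 * c) ^ (q - 2) * 2 ^ (2 * σ)),
    ENNReal.mul_ne_top ENNReal.ofReal_ne_top ENNReal.ofReal_ne_top, fun f m hm hf => ?_⟩
  have hcont := (𝓕 f).continuous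
  rw [lintegral_rpow_eq_lintegral_meas_lt_mul volume (Filter.Eventually.of_forall
    fun x => norm_nonneg (f x)) (f.continuous.norm.measurable.aemeasurable) (by linarith),
    mul_assoc]
  gcongr
  -- The condition R(t) ≤ |ξ|, solved for t, where R(t) is the level-dependent cut-off frequency.
  -- Tonelli can then integrate in t first.
  let S : Set (ℝ × E) := {z | z.1 ≤ 2 * c * m * (2 * ‖z.2‖) ^ β}
  have hS : MeasurableSet S := by
    refine measurableSet_le measurable_fst (Measurable.const_mul ?_ _)
    fun_prop
  let F : ℝ × E → ℝ≥0∞ := S.indicator fun z =>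
    ENNReal.ofReal (4 * z.1 ^ (q - 3)) * ‖(𝓕 f : 𝓢(E, ℂ)) z.2‖ₑ ^ 2
  have hF : Measurable F := by
    refine Measurable.indicator ?_ hS
    have := hcont.measurable
    fun_prop
  calc ∫⁻ t in Set.Ioi 0, volume {a | t < ‖f a‖} * ENNReal.ofReal (t ^ (q - 1))
      ≤ ∫⁻ t in Set.Ioi 0, ∫⁻ ξ, F (t, ξ) := by
        refine setLIntegral_mono (Measurable.lintegral_prod_right' hF) fun t ht => ?_
        have ht0 : 0 < t := ht
        -- The frequency at which the bound c (2R)^β m of the low part equals t/2.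
        set R : ℝ := (t / (2 * c * m)) ^ (1 / β) / 2 with hR
        have hR0 : 0 < R := by positivity
        have h2R : (2 * R) ^ β = t / (2 * c * m) := by
          rw [hR, mul_div_cancel₀ _ (two_ne_zero), ← Real.rpow_mul (by positivity),
            one_div_mul_cancel hβ0.ne', Real.rpow_one]
        have h1 := volume_lt_norm_le hc.le hm.le hR0 ht0 hball (by
          rw [← hd, ← hβ, h2R]; apply le_of_eq; field_simp) f hf
        refine (mul_le_mul_left h1 _).trans ?_
        rw [← lintegral_indicator (measurableSet_le measurable_const measurable_norm),
          ← lintegral_const_mul' _ _ ENNReal.ofReal_ne_top,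
          ← lintegral_mul_const' _ _ ENNReal.ofReal_ne_top]
        refine lintegral_mono fun ξ => ?_
        by_cases h : R ≤ ‖ξ‖
        · have hmem : (t, ξ) ∈ S := by
            have h3 : (2 * R) ^ β ≤ (2 * ‖ξ‖) ^ β := by gcongr
            rw [h2R, div_le_iff₀ (by positivity)] at h3
            change t ≤ _
            linarith
          simp only [F]
          rw [Set.indicator_of_mem (by exact h), Set.indicator_of_mem hmem, mul_right_comm,
            ← ENNReal.ofReal_mul (by positivity)]
          refine mul_le_mul_left (ENNReal.ofReal_le_ofReal (le_of_eq ?_)) _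
          rw [div_mul_eq_mul_div, mul_div_assoc, ← Real.rpow_natCast, ← Real.rpow_sub ht0]
          congr 2
          push_cast
          ring
        · rw [Set.indicator_of_notMem (by exact h)]
          simp
    _ = ∫⁻ ξ, ∫⁻ t in Set.Ioi 0, F (t, ξ) := by
        exact lintegral_lintegral_swap (f := fun t ξ => F (t, ξ)) hF.aemeasurable
    _ ≤ ∫⁻ ξ, ENNReal.ofReal (4 / (q - 2) * (2 * c) ^ (q - 2) * 2 ^ (2 * σ) * m ^ (q - 2)) *
          (ENNReal.ofReal (‖ξ‖ ^ (2 * σ)) * ‖(𝓕 f : 𝓢(E, ℂ)) ξ‖ₑ ^ 2) := by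
        refine lintegral_mono fun ξ => ?_
        set T : ℝ := 2 * c * m * (2 * ‖ξ‖) ^ β with hT
        have hT0 : 0 ≤ T := by positivity
        have hpt : ∀ t ∈ Set.Ioi (0 : ℝ), F (t, ξ) = (Set.Ioc 0 T).indicator
            (fun t => ENNReal.ofReal (t ^ (q - 3)) *
              (4 * ‖(𝓕 f : 𝓢(E, ℂ)) ξ‖ₑ ^ 2)) t := by
          intro t ht
          by_cases h : t ≤ T
          · have h1 : (t, ξ) ∈ S := h
            have h2 : t ∈ Set.Ioc 0 T := ⟨ht, h⟩
            simp only [F]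
            rw [Set.indicator_of_mem h1, Set.indicator_of_mem h2,
              ENNReal.ofReal_mul (by norm_num), ENNReal.ofReal_ofNat]
            ring
          · have h1 : (t, ξ) ∉ S := h
            have h2 : t ∉ Set.Ioc 0 T := fun h' => h h'.2
            simp only [F]
            rw [Set.indicator_of_notMem h1, Set.indicator_of_notMem h2]
        rw [setLIntegral_congr_fun measurableSet_Ioi hpt, lintegral_indicator measurableSet_Ioc,
          Measure.restrict_restrict measurableSet_Ioc,
          Set.inter_eq_left.2 (fun t ht => ht.1), lintegral_mul_const' _ _ (by finiteness),
          lintegral_Ioc_rpow (by linarith) hT0, ← mul_assoc, ← mul_assoc,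
          ← ENNReal.ofReal_mul (by positivity),
          ← ENNReal.ofReal_ofNat, ← ENNReal.ofReal_mul (by
            have : 0 < q - 3 + 1 := by linarith
            positivity)]
        refine mul_le_mul_left (ENNReal.ofReal_le_ofReal (le_of_eq ?_)) _
        have e1 : q - 3 + 1 = q - 2 := by ring
        rw [e1, hT, Real.mul_rpow (by positivity) (by positivity),
          Real.mul_rpow (by positivity) hm.le, ← Real.rpow_mul (by positivity)]
        have e2 : β * (q - 2) = 2 * σ := by rw [hq2]; field_simp
        rw [e2, Real.mul_rpow (x := 2) (y := ‖ξ‖) (by positivity) (by positivity)]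
        ring
    _ ≤ ENNReal.ofReal (4 / (q - 2) * (2 * c) ^ (q - 2) * 2 ^ (2 * σ) * m ^ (q - 2)) *
          ENNReal.ofReal (m ^ 2) := by
        rw [lintegral_const_mul' _ _ ENNReal.ofReal_ne_top]
        gcongr
    _ = _ := by
        rw [← ENNReal.ofReal_mul (by positivity), ← ENNReal.ofReal_mul (by positivity)]
        congr 1
        rw [mul_assoc, ← Real.rpow_natCast m 2, ← Real.rpow_add hm]
        congr 2
        push_cast
        ring

theorem norm_one_sub_fourierChar_sq_le (t : ℝ) :
    ‖(1 : ℂ) - ((Real.fourierChar t : Circle) : ℂ)‖ ^ 2 ≤ 4 * min 1 ((2 * Real.pi * |t|) ^ 2) := by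
  rw [norm_sub_rev, Real.fourierChar_apply]
  have h2 : ‖Complex.exp ((2 * Real.pi * t : ℝ) * Complex.I) - 1‖ ≤ 2 * Real.pi * |t| := by
    have := Real.norm_exp_I_mul_ofReal_sub_one_le (x := 2 * Real.pi * t)
    rw [mul_comm Complex.I] at this
    refine this.trans (le_of_eq ?_)
    rw [Real.norm_eq_abs, abs_mul, abs_of_pos Real.two_pi_pos]
  have h1 : ‖Complex.exp ((2 * Real.pi * t : ℝ) * Complex.I) - 1‖ ≤ 2 := by
    refine (norm_sub_le _ _).trans ?_
    rw [Complex.norm_exp_ofReal_mul_I]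
    norm_num
  rw [mul_min_of_nonneg _ _ (by norm_num)]
  refine le_min ?_ ?_
  · nlinarith [norm_nonneg (Complex.exp ((2 * Real.pi * t : ℝ) * Complex.I) - 1)]
  · nlinarith [norm_nonneg (Complex.exp ((2 * Real.pi * t : ℝ) * Complex.I) - 1)]

/-- The Gagliardo seminorm of a Schwartz function is controlled by the Fourier transform. -/
theorem lintegral_gagliardo_le_of_schwartz {s : ℝ} (hs : s ∈ Set.Ioo (0 : ℝ) 1) :
    ∃ C : ℝ≥0∞, C ≠ ⊤ ∧ ∀ f : 𝓢(E, ℂ),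
      ∫⁻ x, ∫⁻ y, ‖f x - f y‖ₑ ^ 2 *
        ENNReal.ofReal (‖y - x‖ ^ (-((Module.finrank ℝ E : ℝ) + 2 * s))) ≤
      C * ∫⁻ ξ, ENNReal.ofReal (‖ξ‖ ^ (2 * s)) * ‖(𝓕 f : 𝓢(E, ℂ)) ξ‖ₑ ^ 2 := by
  set a : ℝ := -((Module.finrank ℝ E : ℝ) + 2 * s) with ha
  set I := ∫⁻ h : E, ENNReal.ofReal (min 1 (‖h‖ ^ 2) * ‖h‖ ^ a) with hI
  have hI' : I ≠ ⊤ := (lintegral_min_norm_rpow_lt_top (volume : Measure E) hs).ne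
  refine ⟨4 * ENNReal.ofReal ((2 * Real.pi) ^ (2 * s)) * I, by finiteness, fun f => ?_⟩
  have hcont := (𝓕 f).continuous
  have hf := f.continuous
  -- With h = y − x, Plancherel turns the difference f − f(· + h) into the multiplier 1 −
  -- e^{2πi⟨h,ξ⟩}, and integrating its bound in h for fixed ξ gives a multiple of |ξ|^{2s} by
  -- scaling.
  calc ∫⁻ x, ∫⁻ y, ‖f x - f y‖ₑ ^ 2 * ENNReal.ofReal (‖y - x‖ ^ a)
      = ∫⁻ x, ∫⁻ h, ‖f x - f (x + h)‖ₑ ^ 2 * ENNReal.ofReal (‖h‖ ^ a) := by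
        refine lintegral_congr fun x => ?_
        rw [← lintegral_add_left_eq_self _ x]
        simp
    _ = ∫⁻ h, ∫⁻ x, ‖f x - f (x + h)‖ₑ ^ 2 * ENNReal.ofReal (‖h‖ ^ a) := by
        rw [lintegral_lintegral_swap]
        fun_prop
    _ = ∫⁻ h, ∫⁻ ξ, ‖(1 : ℂ) - ((Real.fourierChar (inner ℝ h ξ) : Circle) : ℂ)‖ₑ ^ 2 *
          ‖(𝓕 f : 𝓢(E, ℂ)) ξ‖ₑ ^ 2 * ENNReal.ofReal (‖h‖ ^ a) := by
        refine lintegral_congr fun h => ?_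
        rw [lintegral_mul_const' _ _ ENNReal.ofReal_ne_top,
          lintegral_mul_const' _ _ ENNReal.ofReal_ne_top]
        congr 1
        have h1 := lintegral_fourier_sq (f - SchwartzMap.compSubConstCLM ℂ (-h) f)
        simp only [sub_apply, SchwartzMap.compSubConstCLM_apply, sub_neg_eq_add] at h1
        rw [← h1]
        refine lintegral_congr fun ξ => ?_
        have h2 : 𝓕 (f - SchwartzMap.compSubConstCLM ℂ (-h) f) =
            𝓕 f - 𝓕 (SchwartzMap.compSubConstCLM ℂ (-h) f) :=
          (FourierTransform.fourierCLM ℂ 𝓢(E, ℂ)).map_sub _ _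
        rw [← mul_pow, ← enorm_mul, h2, sub_apply, fourier_compSubConst_apply, sub_mul, one_mul]
    _ ≤ ∫⁻ h, ∫⁻ ξ, ENNReal.ofReal (min 1 ((2 * Real.pi * ‖ξ‖ * ‖h‖) ^ 2) * ‖h‖ ^ a) *
          (4 * ‖(𝓕 f : 𝓢(E, ℂ)) ξ‖ₑ ^ 2) := by
        refine lintegral_mono fun h => lintegral_mono fun ξ => ?_
        have h1 : ‖(1 : ℂ) - ((Real.fourierChar (inner ℝ h ξ) : Circle) : ℂ)‖ₑ ^ 2 ≤
            4 * ENNReal.ofReal (min 1 ((2 * Real.pi * ‖ξ‖ * ‖h‖) ^ 2)) := by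
          rw [← ofReal_norm, ← ENNReal.ofReal_pow (norm_nonneg _), ← ENNReal.ofReal_ofNat,
            ← ENNReal.ofReal_mul (by norm_num)]
          refine ENNReal.ofReal_le_ofReal ((norm_one_sub_fourierChar_sq_le _).trans ?_)
          have := abs_real_inner_le_norm h ξ
          have h3 : 2 * Real.pi * |inner ℝ h ξ| ≤ 2 * Real.pi * ‖ξ‖ * ‖h‖ := by
            rw [mul_assoc _ ‖ξ‖, mul_comm ‖ξ‖]
            gcongr
          gcongr
        rw [ENNReal.ofReal_mul (by positivity)]
        calc _ ≤ 4 * ENNReal.ofReal (min 1 ((2 * Real.pi * ‖ξ‖ * ‖h‖) ^ 2)) *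
              ‖(𝓕 f : 𝓢(E, ℂ)) ξ‖ₑ ^ 2 * ENNReal.ofReal (‖h‖ ^ a) := by gcongr
          _ = _ := by ring
    _ = ∫⁻ ξ, ∫⁻ h, ENNReal.ofReal (min 1 ((2 * Real.pi * ‖ξ‖ * ‖h‖) ^ 2) * ‖h‖ ^ a) *
          (4 * ‖(𝓕 f : 𝓢(E, ℂ)) ξ‖ₑ ^ 2) := by
        rw [lintegral_lintegral_swap]
        fun_prop
    _ = ∫⁻ ξ, 4 * ENNReal.ofReal ((2 * Real.pi) ^ (2 * s)) * I *
          (ENNReal.ofReal (‖ξ‖ ^ (2 * s)) * ‖(𝓕 f : 𝓢(E, ℂ)) ξ‖ₑ ^ 2) := by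
        refine lintegral_congr fun ξ => ?_
        rw [lintegral_mul_const' _ _ (by finiteness),
          lintegral_min_mul_norm_rpow volume hs.1 (by positivity),
          Real.mul_rpow Real.two_pi_pos.le (norm_nonneg _), ENNReal.ofReal_mul (by positivity)]
        ring
    _ = _ := by rw [lintegral_const_mul' _ _ (by finiteness)]

end SchwartzSobolev

variable {n : ℕ} {s : ℝ}

/-! ### The working norm on Hˢ and its bound for Bessel potentials -/

section SobolevNorm

theorem two_le_expo (n : ℕ) (s : ℝ) : 2 ≤ expo n s := le_max_left _ _

/-- Twice the exponent conjugate to `p = max {2, n / (2 * s)}`. -/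
def sobExp (n : ℕ) (s : ℝ) : ℝ := 2 * expo n s / (expo n s - 1)

/-- The norm through which functions in `Hˢ` enter all estimates: the sum of the
norms of `u` in `L^r`, `r = sobExp n s`, and of its fractional gradient in `L²`. -/
def hsNorm (s : ℝ) (u : RSpace n → ℂ) : ℝ≥0∞ :=
  eLpNorm u (ENNReal.ofReal (sobExp n s)) volume + eLpNorm (fracGrad s u) 2 volume

@[simp]
theorem norm_toC (a : RSpace n) : ‖toC a‖ = ‖a‖ := by
  simp [toC, EuclideanSpace.norm_eq]

theorem toC_smul (r : ℝ) (a : RSpace n) : toC (r • a) = (r : ℂ) • toC a := by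
  ext i
  simp [toC]

theorem continuous_toC : Continuous (toC : RSpace n → CSpace n) := by
  refine (PiLp.continuous_toLp 2 _).comp (continuous_pi fun i => ?_)
  fun_prop

theorem fracConst_pos (hn : 1 ≤ n) (hs : s ∈ Set.Ioo (0 : ℝ) 1) : 0 < fracConst n s := by
  have h1 : 0 < Real.Gamma ((n : ℝ) / 2 + s) := Real.Gamma_pos_of_pos (by
    have := hs.1
    positivity)
  have h2 : Real.Gamma (-s) ≠ 0 := Real.Gamma_ne_zero fun m hm => by
    have h3 : s = m := by linarith
    rcases m with _ | m
    · exact hs.1.ne' (by simpa using h3)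
    · have := hs.2
      rw [h3] at this
      push_cast at this
      linarith [m.cast_nonneg (α := ℝ)]
  unfold fracConst
  positivity

theorem norm_alpha (hs : 0 < s) (z : RSpace n × RSpace n) :
    ‖alpha s z‖ = Real.sqrt (fracConst n s) / Real.sqrt 2 *
      ‖z.2 - z.1‖ ^ (-((n : ℝ) / 2 + s)) := by
  rw [alpha, norm_toC, norm_smul, Real.norm_of_nonneg (by positivity)]
  rcases (norm_nonneg (z.2 - z.1)).eq_or_lt with h | h
  -- On the diagonal both sides are 0, because `0 ^ x = 0` for every real `x ≠ 0`, negative ones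
  -- included.
  · rw [← h, Real.zero_rpow (x := -((n : ℝ) / 2 + s))
      (by have := n.cast_nonneg (α := ℝ); linarith)]
    simp
  · rw [Real.rpow_neg h.le, Real.rpow_add_one h.ne']
    field_simp

theorem enorm_alpha_sq (hs : 0 < s) (z : RSpace n × RSpace n) :
    ‖alpha s z‖ₑ ^ 2 = ENNReal.ofReal ((Real.sqrt (fracConst n s) / Real.sqrt 2) ^ 2) *
      ENNReal.ofReal (‖z.2 - z.1‖ ^ (-((n : ℝ) + 2 * s))) := by
  rw [← ofReal_norm, ← ENNReal.ofReal_pow (norm_nonneg _), norm_alpha hs, mul_pow,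
    ENNReal.ofReal_mul (by positivity), ← Real.rpow_mul_natCast (norm_nonneg _)]
  congr 3
  push_cast
  ring

theorem alpha_swap (z : RSpace n × RSpace n) : alpha s z.swap = -alpha s z := by
  rw [alpha, alpha, Prod.snd_swap, Prod.fst_swap, norm_sub_rev, ← neg_sub z.2 z.1, toC_smul,
    toC_smul]
  ext i
  simp only [toC, PiLp.smul_apply, PiLp.neg_apply, smul_eq_mul, Complex.ofReal_neg]
  ring

theorem measurable_alpha : Measurable (alpha s : RSpace n × RSpace n → CSpace n) := by
  unfold alpha
  refine continuous_toC.measurable.comp ?_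
  fun_prop

theorem aestronglyMeasurable_fst {u : RSpace n → ℂ} (hu : AEStronglyMeasurable u) :
    AEStronglyMeasurable fun z : RSpace n × RSpace n => u z.1 :=
  hu.comp_quasiMeasurePreserving Measure.quasiMeasurePreserving_fst

theorem aestronglyMeasurable_snd {u : RSpace n → ℂ} (hu : AEStronglyMeasurable u) :
    AEStronglyMeasurable fun z : RSpace n × RSpace n => u z.2 :=
  hu.comp_quasiMeasurePreserving Measure.quasiMeasurePreserving_snd

theorem aestronglyMeasurable_fracGrad {u : RSpace n → ℂ} (hu : AEStronglyMeasurable u) :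
    AEStronglyMeasurable (fracGrad s u) :=
  ((aestronglyMeasurable_fst hu).sub (aestronglyMeasurable_snd hu)).smul
    measurable_alpha.aestronglyMeasurable

theorem fracGrad_add (u v : RSpace n → ℂ) :
    fracGrad s (u + v) = fracGrad s u + fracGrad s v := by
  ext1 z
  simp only [fracGrad, Pi.add_apply]
  rw [← add_smul]
  ring_nf

theorem one_le_sobExp (n : ℕ) (s : ℝ) : 1 ≤ sobExp n s := by
  have h := two_le_expo n s
  rw [sobExp, le_div_iff₀ (by linarith)]
  linarith

theorem hsNorm_add_le {u v : RSpace n → ℂ} (hu : AEStronglyMeasurable u)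
    (hv : AEStronglyMeasurable v) : hsNorm s (u + v) ≤ hsNorm s u + hsNorm s v := by
  unfold hsNorm
  rw [fracGrad_add, add_add_add_comm]
  refine add_le_add (eLpNorm_add_le hu hv ?_) (eLpNorm_add_le
    (aestronglyMeasurable_fracGrad hu) (aestronglyMeasurable_fracGrad hv) (by norm_num))
  exact ENNReal.one_le_ofReal.2 (one_le_sobExp n s)

theorem eLpNorm_fracGrad_sq (hs : 0 < s) {u : RSpace n → ℂ} (hu : AEStronglyMeasurable u) :
    eLpNorm (fracGrad s u) 2 volume ^ 2 =
      ENNReal.ofReal ((Real.sqrt (fracConst n s) / Real.sqrt 2) ^ 2) *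
        ∫⁻ x, ∫⁻ y, ‖u x - u y‖ₑ ^ 2 * ENNReal.ofReal (‖y - x‖ ^ (-((n : ℝ) + 2 * s))) := by
  rw [eLpNorm_two_sq, Measure.volume_eq_prod, lintegral_prod _
    ((aestronglyMeasurable_fracGrad hu).enorm.pow_const 2),
    ← lintegral_const_mul' _ _ ENNReal.ofReal_ne_top]
  refine lintegral_congr fun x => ?_
  rw [← lintegral_const_mul' _ _ ENNReal.ofReal_ne_top]
  refine lintegral_congr fun y => ?_
  rw [fracGrad, enorm_smul, mul_pow, enorm_alpha_sq hs]
  ring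

/-- Fatou's lemma for `hsNorm`. -/
theorem hsNorm_le_of_tendsto_ae {f : ℕ → RSpace n → ℂ} {u : RSpace n → ℂ}
    (hf : ∀ k, AEStronglyMeasurable (f k)) {M : ℝ≥0∞} (hM : ∀ k, hsNorm s (f k) ≤ M)
    (hlim : ∀ᵐ x, Filter.Tendsto (fun k => f k x) Filter.atTop (nhds (u x))) :
    hsNorm s u ≤ 2 * M := by
  -- The factor 2 arises because each of the two summands of `hsNorm` is bounded by M separately.
  rw [two_mul]
  refine add_le_add ?_ ?_
  · refine (Lp.eLpNorm_lim_le_liminf_eLpNorm hf u hlim).trans ?_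
    refine Filter.liminf_le_of_le (by isBoundedDefault) fun b hb => ?_
    obtain ⟨k, hk⟩ := hb.exists
    exact hk.trans (le_self_add.trans (hM k))
  · refine (Lp.eLpNorm_lim_le_liminf_eLpNorm 
      (fun k => aestronglyMeasurable_fracGrad (s := s) (hf k))
      (fracGrad s u) ?_).trans ?_
    · have h1 := Measure.quasiMeasurePreserving_fst (μ := (volume : Measure (RSpace n)))
        (ν := (volume : Measure (RSpace n))) |>.ae hlim
      have h2 := Measure.quasiMeasurePreserving_snd (μ := (volume : Measure (RSpace n)))
        (ν := (volume : Measure (RSpace n))) |>.ae hlim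
      rw [Measure.volume_eq_prod]
      filter_upwards [h1, h2] with z hz1 hz2
      exact (hz1.sub hz2).smul_const _
    · refine Filter.liminf_le_of_le (by isBoundedDefault) fun b hb => ?_
      obtain ⟨k, hk⟩ := hb.exists
      exact hk.trans (le_add_self.trans (hM k))

open FourierTransform

/-- The Bessel potential of order `t` of a Schwartz function. -/
def schwartzBessel (t : ℝ) : 𝓢(RSpace n, ℂ) →L[ℂ] 𝓢(RSpace n, ℂ) :=
  SchwartzMap.fourierMultiplierCLM ℂ (fun x : RSpace n => (((1 + ‖x‖ ^ 2) ^ (t / 2) : ℝ) : ℂ))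

theorem fourier_schwartzBessel_apply (t : ℝ) (g : 𝓢(RSpace n, ℂ)) (ξ : RSpace n) :
    (𝓕 (schwartzBessel t g) : 𝓢(RSpace n, ℂ)) ξ =
      (((1 + ‖ξ‖ ^ 2) ^ (t / 2) : ℝ) : ℂ) * (𝓕 g : 𝓢(RSpace n, ℂ)) ξ := by
  rw [schwartzBessel, SchwartzMap.fourierMultiplierCLM_apply,
    FourierTransform.fourier_fourierInv_eq, SchwartzMap.smulLeftCLM_apply_apply (by fun_prop),
    smul_eq_mul]

/-- The squared Bessel multiplier (1 + |ξ|²)^{−t} absorbs |ξ|^{2σ} for every σ between 0 and t. It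
is used with σ = 0, with σ = s, and with the order of the critical Sobolev embedding. -/
theorem lintegral_fourier_schwartzBessel_le {t σ : ℝ} (hσ : 0 ≤ σ) (hσt : σ ≤ t)
    (g : 𝓢(RSpace n, ℂ)) :
    ∫⁻ ξ, ENNReal.ofReal (‖ξ‖ ^ (2 * σ)) *
      ‖(𝓕 (schwartzBessel (-t) g) : 𝓢(RSpace n, ℂ)) ξ‖ₑ ^ 2 ≤ eLpNorm g 2 volume ^ 2 := by
  rw [← eLpNorm_fourier_eq, eLpNorm_two_sq]
  refine lintegral_mono fun ξ => ?_
  rw [fourier_schwartzBessel_apply, enorm_mul, mul_pow, ← mul_assoc]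
  refine mul_le_of_le_one_left zero_le ?_
  rw [← ofReal_norm, Complex.norm_real, Real.norm_of_nonneg (by positivity),
    ← ENNReal.ofReal_pow (by positivity), ← ENNReal.ofReal_mul (by positivity)]
  refine ENNReal.ofReal_le_one.2 ?_
  rw [← Real.rpow_mul_natCast (by positivity), Real.rpow_mul (norm_nonneg _)]
  calc (‖ξ‖ ^ (2 : ℝ)) ^ σ * (1 + ‖ξ‖ ^ 2) ^ (-t / 2 * (2 : ℕ))
      ≤ (1 + ‖ξ‖ ^ 2) ^ σ * (1 + ‖ξ‖ ^ 2) ^ (-t / 2 * (2 : ℕ)) := by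
        gcongr
        rw [Real.rpow_ofNat]
        linarith
    _ = (1 + ‖ξ‖ ^ 2) ^ (σ - t) := by
        rw [← Real.rpow_add (by positivity)]
        congr 1
        push_cast
        ring
    _ ≤ 1 := Real.rpow_le_one_of_one_le_of_nonpos (by linarith [sq_nonneg ‖ξ‖]) (by linarith)

theorem eLpNorm_schwartzBessel_le {t : ℝ} (ht : 0 ≤ t) (g : 𝓢(RSpace n, ℂ)) :
    eLpNorm (schwartzBessel (-t) g) 2 volume ≤ eLpNorm g 2 volume := by
  have h := lintegral_fourier_schwartzBessel_le le_rfl ht g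
  simp only [mul_zero, Real.rpow_zero, ENNReal.ofReal_one, one_mul] at h
  rw [lintegral_fourier_sq, ← eLpNorm_two_sq] at h
  exact (ENNReal.pow_le_pow_left_iff two_ne_zero).1 h

/-- The Sobolev embedding and the bound of the Gagliardo seminorm, for Schwartz functions. -/
theorem hsNorm_schwartzBessel_le (hn : 1 ≤ n) (hs : s ∈ Set.Ioo (0 : ℝ) 1) :
    ∃ C : ℝ≥0∞, C ≠ ⊤ ∧ ∀ (g : 𝓢(RSpace n, ℂ)) (m : ℝ), 0 < m →
      eLpNorm g 2 volume ≤ ENNReal.ofReal m →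
      hsNorm s (schwartzBessel (-s) g) ≤ C * ENNReal.ofReal m := by
  have hs0 := hs.1
  have : Nonempty (Fin n) := ⟨⟨0, hn⟩⟩
  have hfin : Module.finrank ℝ (RSpace n) = n := finrank_euclideanSpace_fin
  have hp := two_le_expo n s
  have hn0 : (0 : ℝ) < n := by exact_mod_cast hn
  set p := expo n s with hpdef
  -- The order whose critical exponent 2n/(n − 2σ) is 2p/(p − 1). The bound p ≥ n/(2s) gives σ ≤ s,
  -- and p ≥ 2 gives 2σ < n.
  set σ : ℝ := n / (2 * p) with hσ
  have hσ0 : 0 < σ := by positivity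
  have hσs : σ ≤ s := by
    have : (n : ℝ) / (2 * s) ≤ p := le_max_right _ _
    rw [div_le_iff₀ (by positivity)] at this
    rw [hσ, div_le_iff₀ (by positivity)]
    linarith
  have hσn : 2 * σ < n := by
    have : 2 * σ = n / p := by rw [hσ]; field_simp
    rw [this, div_lt_iff₀ (by positivity)]
    nlinarith
  have hq : sobExp n s = 2 * Module.finrank ℝ (RSpace n) /
      (Module.finrank ℝ (RSpace n) - 2 * σ) := by
    have h1 : p - 1 ≠ 0 := by linarith
    have h2 : (n : ℝ) - 2 * σ = n * (p - 1) / p := by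
      rw [hσ]
      field_simp
    rw [hfin, h2, sobExp, ← hpdef]
    field_simp
  obtain ⟨C₁, hC₁, h1⟩ := lintegral_rpow_le_of_schwartz (E := RSpace n) hσ0
    (by rw [hfin]; exact hσn) hq
  obtain ⟨C₂, hC₂, h2⟩ := lintegral_gagliardo_le_of_schwartz (E := RSpace n) hs
  set r := sobExp n s with hr
  have hr0 : 0 < r := by linarith [one_le_sobExp n s]
  set K := ENNReal.ofReal ((Real.sqrt (fracConst n s) / Real.sqrt 2) ^ 2)
  refine ⟨C₁ ^ (1 / r) + (K * C₂) ^ (1 / 2 : ℝ), by finiteness, fun g m hm hg => ?_⟩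
  set f := schwartzBessel (-s) g
  have hg2 : eLpNorm g 2 volume ^ 2 ≤ ENNReal.ofReal (m ^ 2) := by
    rw [ENNReal.ofReal_pow hm.le]
    gcongr
  rw [add_mul]
  refine add_le_add ?_ ?_
  · have h3 := h1 f m hm ((lintegral_fourier_schwartzBessel_le hσ0.le hσs g).trans hg2)
    rw [eLpNorm_eq_lintegral_rpow_enorm_toReal (by simpa using hr0) ENNReal.ofReal_ne_top,
      ENNReal.toReal_ofReal hr0.le]
    have h4 : ∀ x, ‖f x‖ₑ ^ r = ENNReal.ofReal (‖f x‖ ^ r) := fun x => by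
      rw [← ofReal_norm, ENNReal.ofReal_rpow_of_nonneg (norm_nonneg _) hr0.le]
    simp_rw [h4]
    refine (ENNReal.rpow_le_rpow h3 (by positivity)).trans (le_of_eq ?_)
    rw [ENNReal.mul_rpow_of_nonneg _ _ (by positivity),
      ENNReal.ofReal_rpow_of_nonneg (by positivity) (by positivity), ← Real.rpow_mul hm.le,
      mul_one_div_cancel hr0.ne', Real.rpow_one]
  · have h3 := (h2 f).trans (mul_le_mul_right
      ((lintegral_fourier_schwartzBessel_le hs0.le le_rfl g).trans hg2) C₂)
    rw [hfin] at h3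
    rw [← ENNReal.pow_le_pow_left_iff two_ne_zero,
      eLpNorm_fracGrad_sq hs0 f.continuous.aestronglyMeasurable, mul_pow,
      ← ENNReal.ofReal_pow hm.le, ← ENNReal.rpow_natCast (_ ^ (1 / 2 : ℝ)),
      ← ENNReal.rpow_mul, Nat.cast_ofNat, one_div_mul_cancel two_ne_zero, ENNReal.rpow_one,
      mul_assoc]
    exact mul_le_mul_right h3 _

theorem schwartzBessel_toTemperedDistribution (t : ℝ) (g : 𝓢(RSpace n, ℂ)) :
    TemperedDistribution.besselPotential (RSpace n) ℂ t
      ((g.toLp 2 volume : Lp ℂ 2 (volume : Measure (RSpace n))) : 𝓢'(RSpace n, ℂ)) =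
    (((schwartzBessel t g).toLp 2 volume : Lp ℂ 2 (volume : Measure (RSpace n))) :
      𝓢'(RSpace n, ℂ)) := by
  rw [TemperedDistribution.besselPotential, Lp.toTemperedDistribution_toLp_eq,
    Lp.toTemperedDistribution_toLp_eq,
    TemperedDistribution.fourierMultiplierCLM_toTemperedDistributionCLM_eq (by fun_prop)]
  rfl

end SobolevNorm

/-! ### Density of Schwartz functions -/

section Approximation

/-- Schwartz functions are dense in `Hˢ`, in the sense of `hsNorm`. -/
theorem MemH.exists_schwartz_hsNorm_sub_le (hn : 1 ≤ n) (hs : s ∈ Set.Ioo (0 : ℝ) 1)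
    {u : RSpace n → ℂ} (hu : MemH s u) {ε : ℝ≥0∞} (hε : ε ≠ 0) :
    ∃ f : 𝓢(RSpace n, ℂ), hsNorm s (u - ⇑f) ≤ ε := by
  obtain ⟨C, hC, hbound⟩ := hsNorm_schwartzBessel_le hn hs
  obtain ⟨huL, w, hw⟩ := hu
  have hdense : ∀ k : ℕ, ∃ g : 𝓢(RSpace n, ℂ),
      dist w (g.toLp 2 volume) < 1 / ((k : ℝ) + 1) := fun k => by
    obtain ⟨g, hg⟩ := (SchwartzMap.denseRange_toLpCLM (F := ℂ) (E := RSpace n)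
      (μ := volume) (p := 2) ENNReal.ofNat_ne_top).exists_dist_lt w
        (show (0 : ℝ) < 1 / ((k : ℝ) + 1) by positivity)
    exact ⟨g, hg⟩
  choose g hg using hdense
  have hgw : Filter.Tendsto (fun k => (g k).toLp 2 (volume : Measure (RSpace n))) Filter.atTop
      (nhds w) := by
    refine tendsto_iff_dist_tendsto_zero.2 (squeeze_zero (fun _ => dist_nonneg) (fun k => ?_)
      tendsto_one_div_add_atTop_nhds_zero_nat)
    rw [dist_comm]
    exact (hg k).le
  -- Here w is the L² function representing the Bessel potential of order s of u, so applying order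
  -- −s to approximants of w gives approximants of u, with `hsNorm` of differences controlled by L²
  -- distances of the `g k`.
  let f : ℕ → 𝓢(RSpace n, ℂ) := fun k => schwartzBessel (-s) (g k)
  have hsub : ∀ j k, f j - f k = schwartzBessel (-s) (g j - g k) := fun j k => by
    simp [f]
  have hdist : ∀ h₁ h₂ : 𝓢(RSpace n, ℂ), dist (h₁.toLp 2 (volume : Measure (RSpace n)))
      (h₂.toLp 2 volume) = (eLpNorm (h₁ - h₂ : 𝓢(RSpace n, ℂ)) 2 volume).toReal := by
    intro h₁ h₂
    rw [← SchwartzMap.norm_toLp, dist_eq_norm]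
    congr 1
  have hcau : CauchySeq fun k => (f k).toLp 2 (volume : Measure (RSpace n)) := by
    refine cauchySeq_of_le_tendsto_0 (fun k => 2 / ((k : ℝ) + 1)) (fun j k N hj hk => ?_) ?_
    · rw [hdist, hsub]
      refine (ENNReal.toReal_mono (SchwartzMap.eLpNorm_lt_top _ 2 volume).ne
        (eLpNorm_schwartzBessel_le hs.1.le (g j - g k))).trans ?_
      rw [← hdist]
      have h1 := dist_triangle_left ((g j).toLp 2 volume) ((g k).toLp 2 volume) w
      have h2 : ∀ i, N ≤ i → 1 / ((i : ℝ) + 1) ≤ 1 / ((N : ℝ) + 1) := fun i hi => by gcongr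
      have h3 : 2 / ((N : ℝ) + 1) = 1 / ((N : ℝ) + 1) + 1 / ((N : ℝ) + 1) := by ring
      linarith [hg j, hg k, h2 j hj, h2 k hk]
    · have := tendsto_one_div_add_atTop_nhds_zero_nat (𝕜 := ℝ).const_mul 2
      simpa [div_eq_mul_inv] using this
  obtain ⟨u', hu'⟩ := cauchySeq_tendsto_of_complete hcau
  -- The L² limit is identified among tempered distributions, where the Bessel potential is
  -- continuous and into which L² embeds injectively.
  have huu' : u' = huL.toLp u := by
    have h1 : Filter.Tendsto
        (fun k => Lp.toTemperedDistributionCLM ℂ volume 2 ((f k).toLp 2 volume)) Filter.atTop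
        (nhds (Lp.toTemperedDistributionCLM ℂ volume 2 u')) :=
      ((Lp.toTemperedDistributionCLM ℂ volume 2).continuous.tendsto _).comp hu'
    have h2 : Filter.Tendsto
        (fun k => TemperedDistribution.besselPotential (RSpace n) ℂ (-s)
          (Lp.toTemperedDistributionCLM ℂ volume 2 ((g k).toLp 2 volume))) Filter.atTop
        (nhds (TemperedDistribution.besselPotential (RSpace n) ℂ (-s)
          (Lp.toTemperedDistributionCLM ℂ volume 2 w))) :=
      (((TemperedDistribution.besselPotential (RSpace n) ℂ (-s)).continuous.comp
        (Lp.toTemperedDistributionCLM ℂ volume 2).continuous).tendsto _).comp hgw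
    have h3 : ∀ k, TemperedDistribution.besselPotential (RSpace n) ℂ (-s)
        (Lp.toTemperedDistributionCLM ℂ volume 2 ((g k).toLp 2 volume)) =
        Lp.toTemperedDistributionCLM ℂ volume 2 ((f k).toLp 2 volume) :=
      fun k => schwartzBessel_toTemperedDistribution (-s) (g k)
    simp_rw [h3] at h2
    have h4 := tendsto_nhds_unique h1 h2
    have h5 : TemperedDistribution.besselPotential (RSpace n) ℂ (-s)
        (Lp.toTemperedDistributionCLM ℂ volume 2 w) =
        Lp.toTemperedDistributionCLM ℂ volume 2 (huL.toLp u) :=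
      (TemperedDistribution.besselPotential_neg_apply_eq_iff s _ _).2 hw
    rw [h5] at h4
    exact LinearMap.ker_eq_bot.1 (Lp.ker_toTemperedDistributionCLM_eq_bot (F := ℂ)
      (μ := (volume : Measure (RSpace n))) (p := 2)) h4
  have hmeas : TendstoInMeasure volume (fun k => (f k : RSpace n → ℂ)) Filter.atTop u := by
    have h1 := tendstoInMeasure_of_tendsto_Lp hu'
    rw [huu'] at h1
    refine h1.congr' ?_ huL.coeFn_toLp
    exact Filter.Eventually.of_forall fun k => SchwartzMap.coeFn_toLp _ _ _
  obtain ⟨φ, hφ, hae⟩ := hmeas.exists_seq_tendsto_ae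
  obtain ⟨δ, hδ, hδε⟩ : ∃ δ : ℝ, 0 < δ ∧ 2 * (C * ENNReal.ofReal δ) ≤ ε := by
    have h1 : Filter.Tendsto (fun δ : ℝ => 2 * (C * ENNReal.ofReal δ)) (nhdsWithin 0 (Set.Ioi 0))
        (nhds 0) := by
      have h2 : Filter.Tendsto (fun δ : ℝ => 2 * (C * ENNReal.ofReal δ)) (nhds 0)
        (nhds (2 * (C * ENNReal.ofReal 0))) :=
        ENNReal.Tendsto.const_mul (ENNReal.Tendsto.const_mul
          (ENNReal.continuous_ofReal.tendsto 0) (Or.inr hC)) (Or.inr (by norm_num))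
      simp only [ENNReal.ofReal_zero, mul_zero] at h2
      exact h2.mono_left nhdsWithin_le_nhds
    obtain ⟨δ, h2, h3⟩ := ((h1.eventually (ge_mem_nhds hε.bot_lt)).and
      self_mem_nhdsWithin).exists
    exact ⟨δ, h3, h2⟩
  -- Two approximants of index at least N are each within 1/N of w, hence within δ of each other;
  -- the factor 2 in the choice of δ pays for Fatou's lemma. The shift by N below keeps `φ (k + N)`
  -- at least N.
  obtain ⟨N, hN⟩ := exists_nat_gt (2 / δ)
  refine ⟨f N, le_trans ?_ hδε⟩
  refine hsNorm_le_of_tendsto_ae (f := fun k => (f (φ (k + N)) : RSpace n → ℂ) - ⇑(f N))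
    (fun k => ((f _).continuous.sub (f N).continuous).aestronglyMeasurable) (fun k => ?_) ?_
  · have h0 : (f (φ (k + N)) : RSpace n → ℂ) - ⇑(f N) =
        schwartzBessel (-s) (g (φ (k + N)) - g N) := by
      rw [← hsub]
      rfl
    rw [h0]
    refine hbound _ δ hδ ?_
    rw [← ENNReal.ofReal_toReal (SchwartzMap.eLpNorm_lt_top (g (φ (k + N)) - g N) 2 volume).ne,
      ← hdist]
    refine ENNReal.ofReal_le_ofReal ?_
    have h1 := dist_triangle_left ((g (φ (k + N))).toLp 2 volume) ((g N).toLp 2 volume) w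
    have hN0 : (0 : ℝ) < N := lt_trans (by positivity) hN
    have h2 : ∀ i : ℕ, N ≤ i → 1 / ((i : ℝ) + 1) ≤ 1 / (N : ℝ) := fun i hi => by
      have : (N : ℝ) ≤ i := by exact_mod_cast hi
      gcongr
      linarith
    have h3 : N ≤ φ (k + N) := (Nat.le_add_left N k).trans (hφ.le_apply)
    have h4 : 2 * (1 / (N : ℝ)) ≤ δ := by
      rw [div_lt_iff₀ hδ] at hN
      rw [mul_one_div, div_le_iff₀ hN0]
      linarith
    linarith [hg (φ (k + N)), hg N, h2 _ h3, h2 N le_rfl]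
  · filter_upwards [hae] with x hx
    exact ((Filter.tendsto_add_atTop_iff_nat N).2 hx).sub_const _

end Approximation

/-! ### Density of smooth compactly supported functions -/

section TestFunctions

theorem schwartzBessel_neg_schwartzBessel (t : ℝ) (f : 𝓢(RSpace n, ℂ)) :
    schwartzBessel (-t) (schwartzBessel t f) = f := by
  rw [schwartzBessel, schwartzBessel,
    SchwartzMap.fourierMultiplierCLM_fourierMultiplierCLM_apply (by fun_prop) (by fun_prop)]
  have h : ((fun x : RSpace n => (((1 + ‖x‖ ^ 2) ^ (-t / 2) : ℝ) : ℂ)) *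
      fun x : RSpace n => (((1 + ‖x‖ ^ 2) ^ (t / 2) : ℝ) : ℂ)) = fun _ => 1 := by
    ext x
    rw [Pi.mul_apply, ← Complex.ofReal_mul, ← Real.rpow_add (by positivity)]
    simp [neg_div]
  rw [h, SchwartzMap.fourierMultiplierCLM_const]
  simp

/-- Every Schwartz function is the Bessel potential of order −s of a Schwartz function. -/
theorem hsNorm_schwartz_lt_top (hn : 1 ≤ n) (hs : s ∈ Set.Ioo (0 : ℝ) 1) (f : 𝓢(RSpace n, ℂ)) :
    hsNorm s f < ⊤ := by
  obtain ⟨C, hC, hbound⟩ := hsNorm_schwartzBessel_le hn hs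
  have hfin := SchwartzMap.eLpNorm_lt_top (schwartzBessel s f) 2 volume
  have h := hbound (schwartzBessel s f)
    ((eLpNorm (schwartzBessel s f) 2 volume).toReal + 1) (by positivity) (by
      rw [← ENNReal.ofReal_toReal hfin.ne, ENNReal.toReal_ofReal ENNReal.toReal_nonneg]
      exact ENNReal.ofReal_le_ofReal (by linarith))
  rw [schwartzBessel_neg_schwartzBessel] at h
  exact h.trans_lt (by finiteness)

theorem MemH.aestronglyMeasurable {u : RSpace n → ℂ} (hu : MemH s u) : AEStronglyMeasurable u :=
  hu.choose.1

theorem MemH.hsNorm_lt_top (hn : 1 ≤ n) (hs : s ∈ Set.Ioo (0 : ℝ) 1) {u : RSpace n → ℂ}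
    (hu : MemH s u) : hsNorm s u < ⊤ := by
  obtain ⟨f, hf⟩ := hu.exists_schwartz_hsNorm_sub_le hn hs one_ne_zero
  have hfm : AEStronglyMeasurable f := f.continuous.aestronglyMeasurable
  have h := hsNorm_add_le (s := s) (hu.aestronglyMeasurable.sub hfm) hfm
  rw [sub_add_cancel] at h
  exact h.trans_lt (ENNReal.add_lt_top.2 ⟨hf.trans_lt ENNReal.one_lt_top,
    hsNorm_schwartz_lt_top hn hs f⟩)

theorem memH_of_contDiff {φ : RSpace n → ℂ} (hφ : ContDiff ℝ ∞ φ) (hφ' : HasCompactSupport φ) :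
    MemH s φ := by
  let f : 𝓢(RSpace n, ℂ) := hφ'.toSchwartzMap hφ
  have hfφ : (f : RSpace n → ℂ) = φ := rfl
  have hL : MemLp φ 2 volume := hfφ ▸ f.memLp 2 volume
  refine ⟨hL, ?_⟩
  have h := f.memSobolev (s := s) (p := 2)
  rw [← Lp.toTemperedDistribution_toLp_eq (p := 2)] at h
  exact h

theorem tendsto_eLpNorm_zero_of_dominated {α F : Type*} [MeasurableSpace α] {μ : Measure α}
    [NormedAddCommGroup F] {p : ℝ≥0∞} (hp0 : p ≠ 0) (hp : p ≠ ⊤) {f : ℕ → α → F}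
    (hf : ∀ k, AEStronglyMeasurable (f k) μ) {g : α → ℝ} (hg : MemLp g p μ)
    (hle : ∀ k, ∀ᵐ x ∂μ, ‖f k x‖ ≤ g x)
    (hlim : ∀ᵐ x ∂μ, Filter.Tendsto (fun k => f k x) Filter.atTop (nhds 0)) :
    Filter.Tendsto (fun k => eLpNorm (f k) p μ) Filter.atTop (nhds 0) := by
  have hpos := ENNReal.toReal_pos hp0 hp
  have h1 : Filter.Tendsto (fun k => ∫⁻ x, ‖f k x‖ₑ ^ p.toReal ∂μ) Filter.atTop
      (nhds (∫⁻ _, 0 ∂μ)) := by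
    refine tendsto_lintegral_of_dominated_convergence' (fun x => ‖g x‖ₑ ^ p.toReal)
      (fun k => (hf k).enorm.pow_const _) (fun k => ?_)
      (lintegral_rpow_enorm_lt_top_of_eLpNorm_lt_top hp0 hp hg.2).ne ?_
    · filter_upwards [hle k] with x hx
      refine ENNReal.rpow_le_rpow ?_ hpos.le
      rw [← ofReal_norm, ← ofReal_norm]
      exact ENNReal.ofReal_le_ofReal (hx.trans (le_abs_self _))
    · filter_upwards [hlim] with x hx
      have h2 := (ENNReal.continuous_rpow_const (y := p.toReal)).tendsto _ |>.comp
        (continuous_enorm.tendsto _ |>.comp hx)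
      simpa [Function.comp_def, ENNReal.zero_rpow_of_pos hpos] using h2
  rw [lintegral_zero] at h1
  simp_rw [eLpNorm_eq_lintegral_rpow_enorm_toReal hp0 hp]
  have h3 := (ENNReal.continuous_rpow_const (y := 1 / p.toReal)).tendsto 0 |>.comp h1
  rw [ENNReal.zero_rpow_of_pos (by positivity)] at h3
  exact h3

/-- Dominates, uniformly in the cut-off scale, the product-rule term in which the difference falls
on the cut-off. -/
theorem memLp_mul_min_mul_alpha (hn : 1 ≤ n) (hs : s ∈ Set.Ioo (0 : ℝ) 1) (f : 𝓢(RSpace n, ℂ)) :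
    MemLp (fun z : RSpace n × RSpace n => ‖f z.1‖ * min 1 ‖z.2 - z.1‖ * ‖alpha s z‖) 2 := by
  have : Nonempty (Fin n) := ⟨⟨0, hn⟩⟩
  have hfin : Module.finrank ℝ (RSpace n) = n := finrank_euclideanSpace_fin
  have hf := f.continuous
  have hα := measurable_alpha (n := n) (s := s)
  have hmeas : Measurable fun z : RSpace n × RSpace n =>
      ‖f z.1‖ * min 1 ‖z.2 - z.1‖ * ‖alpha s z‖ :=
    (((hf.comp continuous_fst).norm.mul (by fun_prop)).measurable).mul hα.norm
  refine ⟨hmeas.aestronglyMeasurable, ?_⟩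
  have hI := lintegral_min_norm_rpow_lt_top (volume : Measure (RSpace n)) hs
  rw [hfin] at hI
  have hsq : eLpNorm (fun z : RSpace n × RSpace n =>
      ‖f z.1‖ * min 1 ‖z.2 - z.1‖ * ‖alpha s z‖) 2 volume ^ 2 < ⊤ := by
    rw [eLpNorm_two_sq, Measure.volume_eq_prod, lintegral_prod _ (by fun_prop)]
    have hpt : ∀ x y : RSpace n, ‖‖f x‖ * min 1 ‖y - x‖ * ‖alpha s (x, y)‖‖ₑ ^ 2 =
        (‖f x‖ₑ ^ 2 * ENNReal.ofReal ((Real.sqrt (fracConst n s) / Real.sqrt 2) ^ 2)) *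
        ENNReal.ofReal (min 1 (‖y - x‖ ^ 2) * ‖y - x‖ ^ (-((n : ℝ) + 2 * s))) := by
      intro x y
      rw [enorm_mul, enorm_mul, enorm_norm, enorm_norm, mul_pow, mul_pow, enorm_alpha_sq hs.1,
        ENNReal.ofReal_mul (by positivity)]
      have h1 : ‖min 1 ‖y - x‖‖ₑ ^ 2 = ENNReal.ofReal (min 1 (‖y - x‖ ^ 2)) := by
        rw [← ofReal_norm, ← ENNReal.ofReal_pow (norm_nonneg _),
          Real.norm_of_nonneg (by positivity)]
        congr 1
        rcases le_total 1 ‖y - x‖ with h | h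
        · rw [min_eq_left h, min_eq_left (one_le_pow₀ h), one_pow]
        · rw [min_eq_right h, min_eq_right (pow_le_one₀ (norm_nonneg _) h)]
      rw [h1]
      ring
    simp_rw [hpt]
    have hin : ∀ x : RSpace n, ∫⁻ y : RSpace n,
        ENNReal.ofReal (min 1 (‖y - x‖ ^ 2) * ‖y - x‖ ^ (-((n : ℝ) + 2 * s))) =
        ∫⁻ y : RSpace n, ENNReal.ofReal (min 1 (‖y‖ ^ 2) * ‖y‖ ^ (-((n : ℝ) + 2 * s))) :=
      fun x => lintegral_sub_right_eq_self (fun y : RSpace n =>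
        ENNReal.ofReal (min 1 (‖y‖ ^ 2) * ‖y‖ ^ (-((n : ℝ) + 2 * s)))) x
    simp_rw [lintegral_const_mul' _ _ (ENNReal.mul_ne_top
      (ENNReal.pow_ne_top enorm_ne_top) ENNReal.ofReal_ne_top), hin]
    rw [lintegral_mul_const' _ _ hI.ne, lintegral_mul_const' _ _ ENNReal.ofReal_ne_top,
      ← eLpNorm_two_sq]
    have := SchwartzMap.eLpNorm_lt_top f 2 volume
    finiteness
  simpa using ENNReal.pow_lt_top_iff.1 hsq

/-- Multiply f by the bump χ(x/(k + 1)). The remainder w_k tends to 0 pointwise, and both parts of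
its norm tend to 0 by dominated convergence: the product rule splits w_k(x) − w_k(y) into a
difference of f and a difference of cut-offs. -/
theorem exists_contDiff_hsNorm_schwartz_sub_le (hn : 1 ≤ n) (hs : s ∈ Set.Ioo (0 : ℝ) 1)
    (f : 𝓢(RSpace n, ℂ)) {ε : ℝ≥0∞} (hε : ε ≠ 0) :
    ∃ φ : RSpace n → ℂ, ContDiff ℝ ∞ φ ∧ HasCompactSupport φ ∧ hsNorm s (⇑f - φ) ≤ ε := by
  let χ : ContDiffBump (0 : RSpace n) := ⟨1, 2, one_pos, one_lt_two⟩
  obtain ⟨L, hL⟩ := (χ.contDiff (n := 1)).lipschitzWith_of_hasCompactSupport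
    χ.hasCompactSupport one_ne_zero
  let c : ℕ → RSpace n → RSpace n := fun k x => ((k : ℝ) + 1)⁻¹ • x
  let w : ℕ → RSpace n → ℂ := fun k x => ((1 - χ (c k x) : ℝ) : ℂ) * f x
  have hc : ∀ k, Continuous (c k) := fun k => continuous_const_smul _
  have hwc : ∀ k, Continuous (w k) := fun k =>
    (Complex.continuous_ofReal.comp (continuous_const.sub (χ.continuous.comp (hc k)))).mul
      f.continuous
  have hη : ∀ k x, ‖((1 - χ (c k x) : ℝ) : ℂ)‖ ≤ 1 := fun k x => by
    rw [Complex.norm_real, Real.norm_of_nonneg (by linarith [χ.le_one (x := c k x)])]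
    linarith [χ.nonneg (x := c k x)]
  have hwle : ∀ k x, ‖w k x‖ ≤ ‖f x‖ := fun k x => by
    rw [norm_mul]
    exact mul_le_of_le_one_left (norm_nonneg _) (hη k x)
  have hw0 : ∀ x, Filter.Tendsto (fun k => w k x) Filter.atTop (nhds 0) := by
    intro x
    refine tendsto_const_nhds.congr' ?_
    obtain ⟨N, hN⟩ := exists_nat_gt ‖x‖
    filter_upwards [Filter.eventually_ge_atTop N] with k hk
    have h1 : χ (c k x) = 1 := by
      refine χ.one_of_mem_closedBall ?_
      have : (N : ℝ) ≤ k := by exact_mod_cast hk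
      rw [mem_closedBall_zero_iff, norm_smul, norm_inv, Real.norm_of_nonneg (by positivity),
        inv_mul_le_iff₀ (by positivity)]
      change ‖x‖ ≤ ((k : ℝ) + 1) * 1
      linarith
    simp [w, h1]
  -- The constant L + 1 covers both the trivial bound 1 and the Lipschitz bound L; it is uniform in
  -- k because rescaling by 1/(k + 1) contracts.
  have hLip : ∀ k x y, ‖((1 - χ (c k x) : ℝ) : ℂ) - ((1 - χ (c k y) : ℝ) : ℂ)‖ ≤
      (L + 1) * min 1 ‖y - x‖ := by
    intro k x y
    rw [← Complex.ofReal_sub, Complex.norm_real]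
    have e : 1 - χ (c k x) - (1 - χ (c k y)) = χ (c k y) - χ (c k x) := by ring
    rw [e, mul_min_of_nonneg _ _ (by positivity)]
    refine le_min ?_ ?_
    · rw [Real.norm_eq_abs, abs_le]
      have := L.coe_nonneg
      constructor <;> linarith [χ.nonneg (x := c k x), χ.le_one (x := c k x),
        χ.nonneg (x := c k y), χ.le_one (x := c k y)]
    · refine (hL.norm_sub_le _ _).trans ?_
      have h1 : ‖c k y - c k x‖ ≤ ‖y - x‖ := by
        rw [← smul_sub, norm_smul, norm_inv, Real.norm_of_nonneg (by positivity)]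
        refine mul_le_of_le_one_left (norm_nonneg _) (inv_le_one_of_one_le₀ ?_)
        linarith [k.cast_nonneg (α := ℝ)]
      nlinarith [L.coe_nonneg, norm_nonneg (y - x)]
  have hfin := hsNorm_schwartz_lt_top hn hs f
  have hgm : MemLp (fracGrad s f) 2 volume :=
    ⟨aestronglyMeasurable_fracGrad f.continuous.aestronglyMeasurable, le_add_self.trans_lt hfin⟩
  have hlim : Filter.Tendsto (fun k => hsNorm s (w k)) Filter.atTop (nhds (0 + 0)) := by
    refine Filter.Tendsto.add ?_ ?_
    · have hr := one_le_sobExp n s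
      refine tendsto_eLpNorm_zero_of_dominated (g := fun x => ‖f x‖) (by simp; linarith)
        ENNReal.ofReal_ne_top (fun k => (hwc k).aestronglyMeasurable) (f.memLp _).norm
        (fun k => Filter.Eventually.of_forall (hwle k)) (Filter.Eventually.of_forall hw0)
    · refine tendsto_eLpNorm_zero_of_dominated (g := fun z => ‖fracGrad s f z‖ +
        (L + 1) * (‖f z.1‖ * min 1 ‖z.2 - z.1‖ * ‖alpha s z‖)) (by norm_num) (by norm_num)
        (fun k => aestronglyMeasurable_fracGrad (hwc k).aestronglyMeasurable)
        (hgm.norm.add ((memLp_mul_min_mul_alpha hn hs f).const_mul _))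
        (fun k => Filter.Eventually.of_forall fun z => ?_) (Filter.Eventually.of_forall fun z => ?_)
      · rw [fracGrad, fracGrad, norm_smul, norm_smul]
        have h1 : w k z.1 - w k z.2 = ((1 - χ (c k z.2) : ℝ) : ℂ) * (f z.1 - f z.2) +
            f z.1 * (((1 - χ (c k z.1) : ℝ) : ℂ) - ((1 - χ (c k z.2) : ℝ) : ℂ)) := by
          simp only [w]
          ring
        have h2 : ‖w k z.1 - w k z.2‖ ≤ ‖f z.1 - f z.2‖ +
            ‖f z.1‖ * ((L + 1) * min 1 ‖z.2 - z.1‖) := by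
          rw [h1]
          refine (norm_add_le _ _).trans (add_le_add ?_ ?_)
          · rw [norm_mul]
            exact mul_le_of_le_one_left (norm_nonneg _) (hη k _)
          · rw [norm_mul]
            exact mul_le_mul_of_nonneg_left (hLip k _ _) (norm_nonneg _)
        calc _ ≤ (‖f z.1 - f z.2‖ + ‖f z.1‖ * ((L + 1) * min 1 ‖z.2 - z.1‖)) * ‖alpha s z‖ := by
              gcongr
          _ = _ := by ring
      · have := ((hw0 z.1).sub (hw0 z.2)).smul_const (alpha s z)
        simpa [fracGrad] using this
  rw [add_zero] at hlim
  obtain ⟨k, hk⟩ := (hlim.eventually (ge_mem_nhds hε.bot_lt)).exists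
  refine ⟨fun x => ((χ (c k x) : ℝ) : ℂ) * f x, ?_, ?_, ?_⟩
  · refine ContDiff.mul ?_ (f.smooth ⊤)
    exact Complex.ofRealCLM.contDiff.comp (χ.contDiff.comp (contDiff_const_smul _))
  · refine HasCompactSupport.mul_right ?_
    have h1 : HasCompactSupport fun x => χ (c k x) :=
      χ.hasCompactSupport.comp_homeomorph
        (Homeomorph.smulOfNeZero (((k : ℝ) + 1)⁻¹) (by positivity))
    exact h1.comp_left (g := fun r : ℝ => (r : ℂ)) Complex.ofReal_zero
  · have h1 : (⇑f - fun x => ((χ (c k x) : ℝ) : ℂ) * f x) = w k := by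
      funext x
      change f x - ((χ (c k x) : ℝ) : ℂ) * f x = ((1 - χ (c k x) : ℝ) : ℂ) * f x
      push_cast
      ring
    rwa [h1]

/-- Test functions are dense in `Hˢ`, in the sense of `hsNorm`. -/
theorem MemH.exists_contDiff_hsNorm_sub_le (hn : 1 ≤ n) (hs : s ∈ Set.Ioo (0 : ℝ) 1)
    {u : RSpace n → ℂ} (hu : MemH s u) {ε : ℝ≥0∞} (hε : ε ≠ 0) :
    ∃ φ : RSpace n → ℂ, ContDiff ℝ ∞ φ ∧ HasCompactSupport φ ∧ hsNorm s (u - φ) ≤ ε := by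
  have hε2 : ε / 2 ≠ 0 := (ENNReal.half_pos hε).ne'
  obtain ⟨f, hf⟩ := hu.exists_schwartz_hsNorm_sub_le hn hs hε2
  obtain ⟨φ, h1, h2, h3⟩ := exists_contDiff_hsNorm_schwartz_sub_le hn hs f hε2
  refine ⟨φ, h1, h2, ?_⟩
  have hfm : AEStronglyMeasurable f := f.continuous.aestronglyMeasurable
  have h := hsNorm_add_le (s := s) (hu.aestronglyMeasurable.sub hfm)
    (hfm.sub h1.continuous.aestronglyMeasurable)
  rw [sub_add_sub_cancel] at h
  exact h.trans ((add_le_add hf h3).trans (ENNReal.add_halves ε).le)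

end TestFunctions

/-! ### Potentials as multipliers from Hˢ to L² -/

section Multipliers

/-- Hölder with the conjugate exponents p/(p − 1) and p; `sobExp` is twice the first, which is what
|u|² requires. -/
theorem lintegral_enorm_sq_mul_le {u : RSpace n → ℂ} (hu : AEStronglyMeasurable u)
    {V : RSpace n → ℝ≥0∞} (hV : AEMeasurable V) :
    ∫⁻ x, ‖u x‖ₑ ^ 2 * V x ≤
      hsNorm s u ^ 2 * (∫⁻ x, V x ^ expo n s) ^ (1 / expo n s) := by
  have hp := two_le_expo n s
  set p := expo n s with hpdef
  have hconj : (p / (p - 1)).HolderConjugate p :=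
    (Real.HolderConjugate.conjExponent (by linarith)).symm
  refine (ENNReal.lintegral_mul_le_Lp_mul_Lq volume hconj (hu.enorm.pow_const 2) hV).trans ?_
  gcongr
  have hk : 0 < sobExp n s := by linarith [one_le_sobExp n s]
  have hle : eLpNorm u (ENNReal.ofReal (sobExp n s)) volume ≤ hsNorm s u := le_self_add
  refine le_trans (le_of_eq ?_) (pow_le_pow_left' hle 2)
  rw [eLpNorm_eq_lintegral_rpow_enorm_toReal (by simpa using hk) ENNReal.ofReal_ne_top,
    ENNReal.toReal_ofReal hk.le, ← ENNReal.rpow_natCast, ← ENNReal.rpow_mul]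
  have h1 : sobExp n s = 2 * (p / (p - 1)) := by rw [sobExp, mul_div_assoc]
  have h2 : p - 1 ≠ 0 := by linarith
  have h3 : p ≠ 0 := by linarith
  rw [h1]
  congr 1
  · refine lintegral_congr fun x => ?_
    rw [← ENNReal.rpow_natCast, ← ENNReal.rpow_mul]
    norm_num
  · push_cast
    field_simp

/-- `B` multiplies `Hˢ` into `L²(ℝ²ⁿ)`, in either variable, with norm at most `K`. -/
structure MulBound (s : ℝ) (B : RSpace n × RSpace n → CSpace n) (K : ℝ≥0∞) : Prop where
  aesm : AEStronglyMeasurable B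
  ne_top : K ≠ ⊤
  left : ∀ u : RSpace n → ℂ, AEStronglyMeasurable u →
    eLpNorm (fun z => u z.1 • B z) 2 volume ≤ K * hsNorm s u
  right : ∀ u : RSpace n → ℂ, AEStronglyMeasurable u →
    eLpNorm (fun z => u z.2 • B z) 2 volume ≤ K * hsNorm s u

theorem measurePreserving_prodSwap :
    MeasurePreserving (Prod.swap : RSpace n × RSpace n → RSpace n × RSpace n) volume volume :=
  Measure.measurePreserving_swap

theorem aestronglyMeasurable_swap {F : Type*} [TopologicalSpace F]
    {B : RSpace n × RSpace n → F} (hB : AEStronglyMeasurable B) :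
    AEStronglyMeasurable fun z : RSpace n × RSpace n => B z.swap :=
  hB.comp_measurePreserving measurePreserving_prodSwap

theorem eLpNorm_swap {F : Type*} [NormedAddCommGroup F] {B : RSpace n × RSpace n → F}
    (hB : AEStronglyMeasurable B) :
    eLpNorm (fun z : RSpace n × RSpace n => B z.swap) 2 volume = eLpNorm B 2 volume :=
  eLpNorm_comp_measurePreserving hB measurePreserving_prodSwap

theorem integral_swap_eq {F : Type*} [NormedAddCommGroup F] [NormedSpace ℝ F]
    (B : RSpace n × RSpace n → F) :
    ∫ z : RSpace n × RSpace n, B z.swap = ∫ z, B z :=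
  integral_prod_swap B

theorem aestronglyMeasurable_fst_smul {u : RSpace n → ℂ} (hu : AEStronglyMeasurable u)
    {B : RSpace n × RSpace n → CSpace n} (hB : AEStronglyMeasurable B) :
    AEStronglyMeasurable fun z => u z.1 • B z :=
  (aestronglyMeasurable_fst hu).smul hB

theorem aestronglyMeasurable_snd_smul {u : RSpace n → ℂ} (hu : AEStronglyMeasurable u)
    {B : RSpace n × RSpace n → CSpace n} (hB : AEStronglyMeasurable B) :
    AEStronglyMeasurable fun z => u z.2 • B z :=
  (aestronglyMeasurable_snd hu).smul hB

/-- Integrating in y first leaves |u|² against the weight V = (𝒥₂B)², and V^p = (𝒥₂B)^{2p} is the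
quantity that (p1) makes integrable. -/
theorem eLpNorm_fst_smul_le {B : RSpace n × RSpace n → CSpace n} (hB : AEStronglyMeasurable B)
    {u : RSpace n → ℂ} (hu : AEStronglyMeasurable u) :
    eLpNorm (fun z => u z.1 • B z) 2 volume ≤
      (∫⁻ x, J2 B x ^ (2 * expo n s)) ^ (1 / (2 * expo n s)) * hsNorm s u := by
  have hp := two_le_expo n s
  rw [← ENNReal.pow_le_pow_left_iff two_ne_zero, eLpNorm_two_sq, Measure.volume_eq_prod,
    lintegral_prod _ ((aestronglyMeasurable_fst_smul hu hB).enorm.pow_const 2)]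
  have h1 : ∀ x, ∫⁻ y, ‖u x • B (x, y)‖ₑ ^ 2 = ‖u x‖ₑ ^ 2 * ∫⁻ y, ‖B (x, y)‖ₑ ^ 2 := by
    intro x
    rw [← lintegral_const_mul' _ _ (ENNReal.pow_ne_top enorm_ne_top)]
    simp_rw [enorm_smul, mul_pow]
  have h2 : ∀ x, J2 B x ^ (2 * expo n s) = (∫⁻ y, ‖B (x, y)‖ₑ ^ 2) ^ expo n s := by
    intro x
    rw [J2, ← ENNReal.rpow_mul]
    congr 1
    ring
  simp_rw [h1, h2]
  refine (lintegral_enorm_sq_mul_le (s := s) hu ?_).trans (le_of_eq ?_)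
  · exact AEMeasurable.lintegral_prod_right' (hB.enorm.pow_const 2)
  · rw [mul_pow, mul_comm]
    congr 1
    rw [← ENNReal.rpow_natCast, ← ENNReal.rpow_mul]
    congr 1
    push_cast
    field_simp

theorem MemP0.mulBound {Ω : Set (RSpace n)} {A : RSpace n × RSpace n → CSpace n}
    {q : RSpace n → ℝ} (h : MemP0 s Ω A q) : ∃ K, MulBound s A K := by
  have hp := two_le_expo n s
  have hfin : ∀ I : ℝ≥0∞, I < ⊤ → I ^ (1 / (2 * expo n s)) ≠ ⊤ := fun I hI =>
    ENNReal.rpow_ne_top_of_nonneg (by positivity) hI.ne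
  refine ⟨(∫⁻ x, J1 A x ^ (2 * expo n s)) ^ (1 / (2 * expo n s)) +
    (∫⁻ x, J2 A x ^ (2 * expo n s)) ^ (1 / (2 * expo n s)), h.meas,
    ENNReal.add_ne_top.2 ⟨hfin _ h.J1_mem, hfin _ h.J2_mem⟩, fun u hu => ?_, fun u hu => ?_⟩
  · refine (eLpNorm_fst_smul_le (s := s) h.meas hu).trans ?_
    gcongr
    exact le_add_self
  -- Multiplication in the second variable is multiplication in the first after a swap, and 𝒥₂ of
  -- the swapped potential is 𝒥₁A.
  · have h1 := eLpNorm_fst_smul_le (s := s) (aestronglyMeasurable_swap h.meas) hu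
    rw [← eLpNorm_swap (aestronglyMeasurable_fst_smul hu (aestronglyMeasurable_swap h.meas))]
      at h1
    refine h1.trans ?_
    gcongr
    exact le_self_add

theorem MulBound.swap {B : RSpace n × RSpace n → CSpace n} {K : ℝ≥0∞} (h : MulBound s B K) :
    MulBound s (fun z => B z.swap) K where
  aesm := aestronglyMeasurable_swap h.aesm
  ne_top := h.ne_top
  left u hu := (eLpNorm_swap (aestronglyMeasurable_snd_smul hu h.aesm)).trans_le (h.right u hu)
  right u hu := (eLpNorm_swap (aestronglyMeasurable_fst_smul hu h.aesm)).trans_le (h.left u hu)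

theorem MulBound.add {B B' : RSpace n × RSpace n → CSpace n} {K K' : ℝ≥0∞}
    (h : MulBound s B K) (h' : MulBound s B' K') : MulBound s (fun z => B z + B' z) (K + K') where
  aesm := h.aesm.add h'.aesm
  ne_top := ENNReal.add_ne_top.2 ⟨h.ne_top, h'.ne_top⟩
  left u hu := by
    simp_rw [smul_add, add_mul]
    exact (eLpNorm_add_le (aestronglyMeasurable_fst_smul hu h.aesm)
      (aestronglyMeasurable_fst_smul hu h'.aesm) (by norm_num)).trans
      (add_le_add (h.left u hu) (h'.left u hu))
  right u hu := by
    simp_rw [smul_add, add_mul]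
    exact (eLpNorm_add_le (aestronglyMeasurable_snd_smul hu h.aesm)
      (aestronglyMeasurable_snd_smul hu h'.aesm) (by norm_num)).trans
      (add_le_add (h.right u hu) (h'.right u hu))

theorem MulBound.const_smul {B : RSpace n × RSpace n → CSpace n} {K : ℝ≥0∞}
    (h : MulBound s B K) (c : ℂ) : MulBound s (fun z => c • B z) (‖c‖ₑ * K) where
  aesm := h.aesm.const_smul c
  ne_top := ENNReal.mul_ne_top enorm_ne_top h.ne_top
  left u hu := by
    simp_rw [smul_comm _ c]
    exact (eLpNorm_const_smul c (fun z : RSpace n × RSpace n => u z.1 • B z) 2 volume).trans_le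
      ((mul_le_mul_right (h.left u hu) _).trans_eq (mul_assoc _ _ _).symm)
  right u hu := by
    simp_rw [smul_comm _ c]
    exact (eLpNorm_const_smul c (fun z : RSpace n × RSpace n => u z.2 • B z) 2 volume).trans_le
      ((mul_le_mul_right (h.right u hu) _).trans_eq (mul_assoc _ _ _).symm)

theorem MulBound.symPart {B : RSpace n × RSpace n → CSpace n} {K : ℝ≥0∞} (h : MulBound s B K) :
    ∃ K', MulBound s (symPart B) K' :=
  ⟨_, (h.add h.swap).const_smul (1 / 2)⟩

theorem MulBound.antiPart {B : RSpace n × RSpace n → CSpace n} {K : ℝ≥0∞} (h : MulBound s B K) :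
    ∃ K', MulBound s (antiPart B) K' := by
  obtain ⟨K', h'⟩ := h.symPart
  have h1 : FracMag.antiPart B = fun z => B z + (-1 : ℂ) • FracMag.symPart B z := by
    ext1 z
    rw [FracMag.antiPart, neg_one_smul, sub_eq_add_neg]
  rw [h1]
  exact ⟨_, h.add (h'.const_smul (-1))⟩

theorem MemP0.lintegral_q_lt_top {Ω : Set (RSpace n)} (hΩ : IsOpen Ω)
    {A : RSpace n × RSpace n → CSpace n} {q : RSpace n → ℝ} (h : MemP0 s Ω A q) :
    AEStronglyMeasurable q ∧ ∫⁻ x, ‖q x‖ₑ ^ expo n s < ⊤ := by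
  have hp : 0 < expo n s := by linarith [two_le_expo n s]
  have hzero : q =ᵐ[volume.restrict Ωᶜ] 0 := h.q_zero
  refine ⟨?_, ?_⟩
  · have h1 : AEStronglyMeasurable q (volume.restrict (Ω ∪ Ωᶜ)) :=
      aestronglyMeasurable_union_iff.2
        ⟨h.q_mem.1, aestronglyMeasurable_const.congr hzero.symm⟩
    rwa [Set.union_compl_self, Measure.restrict_univ] at h1
  · rw [← lintegral_add_compl _ hΩ.measurableSet]
    have h1 := lintegral_rpow_enorm_lt_top_of_eLpNorm_lt_top (by simpa using hp)
      ENNReal.ofReal_ne_top h.q_mem.2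
    rw [ENNReal.toReal_ofReal hp.le] at h1
    have h2 : ∫⁻ x in Ωᶜ, ‖q x‖ₑ ^ expo n s = 0 := by
      rw [lintegral_congr_ae (g := fun _ => 0), lintegral_zero]
      filter_upwards [hzero] with x hx
      simp [hx, ENNReal.zero_rpow_of_pos hp]
    rw [h2, add_zero]
    exact h1

/-- Distributes |q| evenly, so that q u v is bounded by a product of two L² functions. -/
theorem MemP0.exists_eLpNorm_sqrt_mul_le {Ω : Set (RSpace n)} (hΩ : IsOpen Ω)
    {A : RSpace n × RSpace n → CSpace n} {q : RSpace n → ℝ} (h : MemP0 s Ω A q) :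
    ∃ K : ℝ≥0∞, K ≠ ⊤ ∧ ∀ u : RSpace n → ℂ, AEStronglyMeasurable u →
      eLpNorm (fun x => ((Real.sqrt |q x| : ℝ) : ℂ) * u x) 2 volume ≤ K * hsNorm s u := by
  have hp := two_le_expo n s
  obtain ⟨hq, hfin⟩ := h.lintegral_q_lt_top hΩ
  refine ⟨((∫⁻ x, ‖q x‖ₑ ^ expo n s) ^ (1 / expo n s)) ^ (1 / 2 : ℝ),
    ENNReal.rpow_ne_top_of_nonneg (by norm_num)
      (ENNReal.rpow_ne_top_of_nonneg (by positivity) hfin.ne), fun u hu => ?_⟩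
  rw [← ENNReal.pow_le_pow_left_iff two_ne_zero, eLpNorm_two_sq, mul_pow,
    ← ENNReal.rpow_natCast (_ ^ (1 / 2 : ℝ)), ← ENNReal.rpow_mul, Nat.cast_ofNat,
    one_div_mul_cancel two_ne_zero, ENNReal.rpow_one, mul_comm]
  refine le_trans (le_of_eq ?_) (lintegral_enorm_sq_mul_le (s := s) hu hq.enorm)
  refine lintegral_congr fun x => ?_
  rw [enorm_mul, mul_pow, mul_comm]
  congr 1
  rw [← ofReal_norm, Complex.norm_real, Real.norm_of_nonneg (Real.sqrt_nonneg _),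
    ← ENNReal.ofReal_pow (Real.sqrt_nonneg _), Real.sq_sqrt (abs_nonneg _), ← ofReal_norm,
    Real.norm_eq_abs]

end Multipliers

/-! ### The bilinear dot product and parallel parts -/

section Dot

theorem norm_dot_le (a b : CSpace n) : ‖dot a b‖ ≤ ‖a‖ * ‖b‖ := by
  rw [dot, EuclideanSpace.norm_eq, EuclideanSpace.norm_eq]
  refine (norm_sum_le _ _).trans ?_
  simp_rw [norm_mul]
  exact Real.sum_mul_le_sqrt_mul_sqrt _ _ _

theorem dot_add_left (a b c : CSpace n) : dot (a + b) c = dot a c + dot b c := by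
  simp [dot, add_mul, Finset.sum_add_distrib]

theorem dot_add_right (a b c : CSpace n) : dot a (b + c) = dot a b + dot a c := by
  simp [dot, mul_add, Finset.sum_add_distrib]

theorem dot_smul_left (r : ℂ) (a b : CSpace n) : dot (r • a) b = r * dot a b := by
  simp [dot, Finset.mul_sum, mul_assoc]

theorem dot_smul_right (r : ℂ) (a b : CSpace n) : dot a (r • b) = r * dot a b := by
  simp [dot, Finset.mul_sum, mul_left_comm]

theorem dot_comm (a b : CSpace n) : dot a b = dot b a := by
  simp [dot, mul_comm]

theorem aestronglyMeasurable_dot {α : Type*} [MeasurableSpace α] {μ : Measure α}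
    {F G : α → CSpace n} (hF : AEStronglyMeasurable F μ) (hG : AEStronglyMeasurable G μ) :
    AEStronglyMeasurable (fun z => dot (F z) (G z)) μ := by
  unfold dot
  refine Finset.aestronglyMeasurable_fun_sum _ fun i _ => AEStronglyMeasurable.mul ?_ ?_
  · exact (EuclideanSpace.proj (𝕜 := ℂ) i).continuous.comp_aestronglyMeasurable hF
  · exact (EuclideanSpace.proj (𝕜 := ℂ) i).continuous.comp_aestronglyMeasurable hG

theorem lintegral_enorm_dot_le {α : Type*} [MeasurableSpace α] {μ : Measure α}
    {F G : α → CSpace n} (hF : AEStronglyMeasurable F μ) (hG : AEStronglyMeasurable G μ) :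
    ∫⁻ z, ‖dot (F z) (G z)‖ₑ ∂μ ≤ eLpNorm F 2 μ * eLpNorm G 2 μ := by
  have h1 := ENNReal.lintegral_mul_le_Lp_mul_Lq μ Real.HolderConjugate.two_two hF.enorm hG.enorm
  rw [eLpNorm_eq_lintegral_rpow_enorm_toReal (by norm_num) (by norm_num),
    eLpNorm_eq_lintegral_rpow_enorm_toReal (by norm_num) (by norm_num)]
  simp only [ENNReal.toReal_ofNat]
  refine le_trans (lintegral_mono fun z => ?_) h1
  rw [Pi.mul_apply, ← ofReal_norm, ← ofReal_norm, ← ofReal_norm,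
    ← ENNReal.ofReal_mul (norm_nonneg _)]
  exact ENNReal.ofReal_le_ofReal (norm_dot_le _ _)

theorem integrable_dot {α : Type*} [MeasurableSpace α] {μ : Measure α}
    {F G : α → CSpace n} (hF : MemLp F 2 μ) (hG : MemLp G 2 μ) :
    Integrable (fun z => dot (F z) (G z)) μ :=
  ⟨aestronglyMeasurable_dot hF.1 hG.1, (lintegral_enorm_dot_le hF.1 hG.1).trans_lt
    (ENNReal.mul_lt_top hF.2 hG.2)⟩

/-- α is a multiple of the real vector x − y, so it does not see the component of B removed by the
projection. On the diagonal nothing is removed. -/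
theorem dot_parPart_alpha (B : RSpace n × RSpace n → CSpace n) (z : RSpace n × RSpace n) :
    dot (parPart B z) (alpha s z) = dot (B z) (alpha s z) := by
  rw [parPart]
  split_ifs with h
  · rfl
  have h0 : ((‖z.1 - z.2‖ ^ 2 : ℝ) : ℂ) ≠ 0 := by
    have : ‖z.1 - z.2‖ ≠ 0 := norm_ne_zero_iff.2 (sub_ne_zero.2 h)
    exact_mod_cast pow_ne_zero 2 this
  have h1 : ∃ r : ℂ, alpha s z = r • toC (z.1 - z.2) := by
    refine ⟨((-(Real.sqrt (fracConst n s) / Real.sqrt 2 /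
      ‖z.2 - z.1‖ ^ ((n : ℝ) / 2 + s + 1)) : ℝ) : ℂ), ?_⟩
    rw [← toC_smul, alpha, ← neg_sub z.1 z.2, smul_neg, neg_smul, norm_neg]
  obtain ⟨r, hr⟩ := h1
  have h2 : dot (toC (z.1 - z.2)) (toC (z.1 - z.2)) = ((‖z.1 - z.2‖ ^ 2 : ℝ) : ℂ) := by
    rw [dot_self_of_real _ fun i => by simp [toC], norm_toC]
  rw [hr, dot_smul_left, dot_smul_right, dot_smul_right, h2]
  field_simp

end Dot

/-! ### Decomposition and continuity of the magnetic form -/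

section Forms

/-- The functions on which all forms below are finite. -/
structure HsFinite (s : ℝ) (u : RSpace n → ℂ) : Prop where
  aesm : AEStronglyMeasurable u
  lt_top : hsNorm s u < ⊤

theorem MemH.hsFinite (hn : 1 ≤ n) (hs : s ∈ Set.Ioo (0 : ℝ) 1) {u : RSpace n → ℂ}
    (hu : MemH s u) : HsFinite s u :=
  ⟨hu.aestronglyMeasurable, hu.hsNorm_lt_top hn hs⟩

variable {u v : RSpace n → ℂ} {B : RSpace n × RSpace n → CSpace n} {K : ℝ≥0∞}

theorem HsFinite.memLp_fracGrad (hu : HsFinite s u) : MemLp (fracGrad s u) 2 :=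
  ⟨aestronglyMeasurable_fracGrad hu.aesm, le_add_self.trans_lt hu.lt_top⟩

theorem MulBound.memLp_left (h : MulBound s B K) (hu : HsFinite s u) :
    MemLp (fun z => u z.1 • B z) 2 :=
  ⟨aestronglyMeasurable_fst_smul hu.aesm h.aesm,
    (h.left u hu.aesm).trans_lt (ENNReal.mul_lt_top h.ne_top.lt_top hu.lt_top)⟩

theorem MulBound.memLp_right (h : MulBound s B K) (hu : HsFinite s u) :
    MemLp (fun z => u z.2 • B z) 2 :=
  ⟨aestronglyMeasurable_snd_smul hu.aesm h.aesm,
    (h.right u hu.aesm).trans_lt (ENNReal.mul_lt_top h.ne_top.lt_top hu.lt_top)⟩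

theorem MulBound.integrable_diff_mul_diff (h : MulBound s B K) (hu : HsFinite s u)
    (hv : HsFinite s v) :
    Integrable fun z => (u z.1 - u z.2) * (v z.1 - v z.2) * dot (B z) (alpha s z) := by
  refine ((integrable_dot (h.memLp_left hu) hv.memLp_fracGrad).sub
    (integrable_dot (h.memLp_right hu) hv.memLp_fracGrad)).congr
    (Filter.Eventually.of_forall fun z => ?_)
  simp only [fracGrad, dot_smul_left, dot_smul_right, Pi.sub_apply]
  ring

/-- Discrete Leibniz rule u(x)v(x) − u(y)v(y) = u(x)(v(x) − v(y)) + v(y)(u(x) − u(y)). Each term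
becomes a multiplied function against a fractional gradient, which is why `MulBound` is needed in
both variables. -/
theorem mul_sub_mul_mul_dot (z : RSpace n × RSpace n) :
    (u z.1 * v z.1 - u z.2 * v z.2) * dot (B z) (alpha s z) =
      dot (u z.1 • B z) (fracGrad s v z) + dot (v z.2 • B z) (fracGrad s u z) := by
  simp only [fracGrad, dot_smul_left, dot_smul_right]
  ring

theorem MulBound.integrable_mul_diff (h : MulBound s B K) (hu : HsFinite s u)
    (hv : HsFinite s v) :
    Integrable fun z => (u z.1 * v z.1 - u z.2 * v z.2) * dot (B z) (alpha s z) := by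
  simp_rw [mul_sub_mul_mul_dot]
  exact (integrable_dot (h.memLp_left hu) hv.memLp_fracGrad).add
    (integrable_dot (h.memLp_right hv) hu.memLp_fracGrad)

theorem MulBound.enorm_integral_mul_diff_le (h : MulBound s B K) (hu : HsFinite s u)
    (hv : HsFinite s v) :
    ‖∫ z, (u z.1 * v z.1 - u z.2 * v z.2) * dot (B z) (alpha s z)‖ₑ ≤
      2 * K * hsNorm s u * hsNorm s v := by
  simp_rw [mul_sub_mul_mul_dot]
  rw [integral_add (integrable_dot (h.memLp_left hu) hv.memLp_fracGrad)
    (integrable_dot (h.memLp_right hv) hu.memLp_fracGrad)]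
  have hle : ∀ w : RSpace n → ℂ, eLpNorm (fracGrad s w) 2 volume ≤ hsNorm s w :=
    fun w => le_add_self
  have h1 := lintegral_enorm_dot_le (h.memLp_left hu).1 hv.memLp_fracGrad.1
  have h2 := lintegral_enorm_dot_le (h.memLp_right hv).1 hu.memLp_fracGrad.1
  calc _ ≤ K * hsNorm s u * hsNorm s v + K * hsNorm s v * hsNorm s u := by
        refine (enorm_add_le _ _).trans (add_le_add ?_ ?_)
        · exact (enorm_integral_le_lintegral_enorm _).trans
            (h1.trans (mul_le_mul' (h.left u hu.aesm) (hle v)))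
        · exact (enorm_integral_le_lintegral_enorm _).trans
            (h2.trans (mul_le_mul' (h.right v hv.aesm) (hle u)))
    _ = _ := by ring

/-- No integrability is needed: the swap preserves the Bochner integral even when it takes its
default value 0. -/
theorem integral_eq_zero_of_swap_neg {F : RSpace n × RSpace n → ℂ} (hF : ∀ z, F z.swap = -F z) :
    ∫ z, F z = 0 := by
  have h := integral_swap_eq F
  simp_rw [hF] at h
  rw [integral_neg] at h
  exact self_eq_neg.1 h.symm

theorem symPart_swap (A : RSpace n × RSpace n → CSpace n) (z : RSpace n × RSpace n) :
    symPart A z.swap = symPart A z := by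
  rw [symPart, symPart, Prod.swap_swap, add_comm]

theorem antiPart_swap (A : RSpace n × RSpace n → CSpace n) (z : RSpace n × RSpace n) :
    antiPart A z.swap = -antiPart A z := by
  rw [antiPart, symPart_swap, antiPart, symPart]
  module

theorem dot_neg_right (a b : CSpace n) : dot a (-b) = -dot a b := by
  simp [dot]

theorem dot_neg_left (a b : CSpace n) : dot (-a) b = -dot a b := by
  simp [dot]

/-- The part of the magnetic form that involves the antisymmetric part of the potential. -/
def antiForm (s : ℝ) (A : RSpace n × RSpace n → CSpace n) (u v : RSpace n → ℂ) : ℂ :=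
  ∫ z, (u z.1 - u z.2) * (v z.1 - v z.2) * dot (antiPart A z) (alpha s z)

theorem lintegral_enorm_mul_le {α : Type*} [MeasurableSpace α] {μ : Measure α}
    {f g : α → ℂ} (hf : AEStronglyMeasurable f μ) (hg : AEStronglyMeasurable g μ) :
    ∫⁻ z, ‖f z * g z‖ₑ ∂μ ≤ eLpNorm f 2 μ * eLpNorm g 2 μ := by
  have h1 := ENNReal.lintegral_mul_le_Lp_mul_Lq μ Real.HolderConjugate.two_two hf.enorm hg.enorm
  rw [eLpNorm_eq_lintegral_rpow_enorm_toReal (by norm_num) (by norm_num),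
    eLpNorm_eq_lintegral_rpow_enorm_toReal (by norm_num) (by norm_num)]
  simp only [ENNReal.toReal_ofNat]
  refine le_trans (lintegral_mono fun z => ?_) h1
  rw [Pi.mul_apply, enorm_mul]

variable {Ω : Set (RSpace n)} {A : RSpace n × RSpace n → CSpace n} {q : RSpace n → ℝ}

theorem MemP0.exists_lintegral_q_le (hΩ : IsOpen Ω) (h : MemP0 s Ω A q) :
    ∃ K : ℝ≥0∞, K ≠ ⊤ ∧ ∀ u v : RSpace n → ℂ, AEStronglyMeasurable u → AEStronglyMeasurable v →
      ∫⁻ x, ‖(q x : ℂ) * u x * v x‖ₑ ≤ K * hsNorm s u * hsNorm s v := by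
  obtain ⟨K, hK, hle⟩ := h.exists_eLpNorm_sqrt_mul_le hΩ
  have hqm := (h.lintegral_q_lt_top hΩ).1
  have hr : AEStronglyMeasurable fun x => ((Real.sqrt |q x| : ℝ) : ℂ) :=
    Complex.continuous_ofReal.comp_aestronglyMeasurable
      (Real.continuous_sqrt.comp_aestronglyMeasurable
        (continuous_abs.comp_aestronglyMeasurable hqm))
  refine ⟨K * K, ENNReal.mul_ne_top hK hK, fun u v hu hv => ?_⟩
  calc ∫⁻ x, ‖(q x : ℂ) * u x * v x‖ₑ
      = ∫⁻ x, ‖(((Real.sqrt |q x| : ℝ) : ℂ) * u x) * (((Real.sqrt |q x| : ℝ) : ℂ) * v x)‖ₑ := by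
        refine lintegral_congr fun x => ?_
        rw [← ofReal_norm, ← ofReal_norm, norm_mul, norm_mul, norm_mul, norm_mul, norm_mul,
          Complex.norm_real, Complex.norm_real, Real.norm_of_nonneg (Real.sqrt_nonneg _),
          Real.norm_eq_abs]
        congr 1
        nth_rewrite 1 [← Real.mul_self_sqrt (abs_nonneg (q x))]
        ring
    _ ≤ _ := lintegral_enorm_mul_le (hr.mul hu) (hr.mul hv)
    _ ≤ K * hsNorm s u * (K * hsNorm s v) := mul_le_mul' (hle u hu) (hle v hv)
    _ = _ := by ring

theorem MemP0.integrable_q_mul (hΩ : IsOpen Ω) (h : MemP0 s Ω A q) (hu : HsFinite s u)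
    (hv : HsFinite s v) : Integrable fun x => (q x : ℂ) * u x * v x := by
  obtain ⟨K, hK, hle⟩ := h.exists_lintegral_q_le hΩ
  refine ⟨((Complex.continuous_ofReal.comp_aestronglyMeasurable
    (h.lintegral_q_lt_top hΩ).1).mul hu.aesm).mul hv.aesm, ?_⟩
  exact (hle u v hu.aesm hv.aesm).trans_lt
    (ENNReal.mul_lt_top (ENNReal.mul_lt_top hK.lt_top hu.lt_top) hv.lt_top)

/-- `Q` on a product of two functions in `Hˢ`. -/
theorem MemP0.Q_mul (hΩ : IsOpen Ω) (h : MemP0 s Ω A q) (hu : HsFinite s u)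
    (hv : HsFinite s v) :
    Q s A q (fun x => u x * v x) = (∫ x, (q x : ℂ) * u x * v x) +
      (∫ z, dot (u z.1 • A z) (v z.1 • A z)) +
      ∫ z, (u z.1 * v z.1 - u z.2 * v z.2) * dot (symPart A z) (alpha s z) := by
  obtain ⟨K, hK⟩ := h.mulBound
  have hF := integrable_dot (hK.memLp_left hu) (hK.memLp_left hv)
  have hin : ∀ x, ∫ y, dot (u x • A (x, y)) (v x • A (x, y)) =
      (∫ y, dot (A (x, y)) (A (x, y))) * (u x * v x) := by
    intro x
    simp_rw [dot_smul_left, dot_smul_right, ← mul_assoc]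
    rw [integral_const_mul]
    ring
  have h1 := hF.integral_prod_left
  simp only [hin] at h1
  have h2 : ∫ z, dot (u z.1 • A z) (v z.1 • A z) =
      ∫ x, (∫ y, dot (A (x, y)) (A (x, y))) * (u x * v x) := by
    rw [Measure.volume_eq_prod, integral_prod _ hF]
    simp only [hin]
  have hq := h.integrable_q_mul hΩ hu hv
  have h3 : ∫ x, ((q x : ℂ) + ∫ y, dot (A (x, y)) (A (x, y))) * (u x * v x) =
      (∫ x, (q x : ℂ) * u x * v x) + ∫ x, (∫ y, dot (A (x, y)) (A (x, y))) * (u x * v x) := by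
    rw [← integral_add hq h1]
    refine integral_congr_ae (Filter.Eventually.of_forall fun x => ?_)
    simp only
    ring
  rw [Q, fracDiv, h3, h2]
  congr 1
  refine integral_congr_ae (Filter.Eventually.of_forall fun z => ?_)
  simp only [fracGrad, dot_smul_right, dot_parPart_alpha]

/-- The magnetic Schrödinger form in terms of the antisymmetric part of the potential and `Q`. -/
theorem MemP0.magSchrodinger_eq (hΩ : IsOpen Ω) (h : MemP0 s Ω A q) (hu : HsFinite s u)
    (hv : HsFinite s v) :
    magSchrodinger s A q u v = (∫ z, dot (fracGrad s u z) (fracGrad s v z)) +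
      antiForm s A u v + Q s A q (fun x => u x * v x) := by
  obtain ⟨K, hK⟩ := h.mulBound
  obtain ⟨Ks, hKs⟩ := hK.symPart
  obtain ⟨Ka, hKa⟩ := hK.antiPart
  have i1 := integrable_dot hu.memLp_fracGrad hv.memLp_fracGrad
  have i2 := hKa.integrable_diff_mul_diff hu hv
  have i3 := hKs.integrable_diff_mul_diff hu hv
  have i4 := hKs.integrable_mul_diff hu hv
  have i5 := hKa.integrable_mul_diff hu hv
  have i6 := integrable_dot (hK.memLp_left hu) (hK.memLp_left hv)
  have j2 := i1.fun_add i2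
  have j3 := j2.fun_add i3
  have j4 := j3.fun_add i4
  have j5 := j4.fun_add i5
  have z3 : ∫ z, (u z.1 - u z.2) * (v z.1 - v z.2) * dot (symPart A z) (alpha s z) = 0 := by
    refine integral_eq_zero_of_swap_neg fun z => ?_
    rw [symPart_swap, alpha_swap, dot_neg_right, Prod.fst_swap, Prod.snd_swap]
    ring
  have z5 : ∫ z, (u z.1 * v z.1 - u z.2 * v z.2) * dot (antiPart A z) (alpha s z) = 0 := by
    refine integral_eq_zero_of_swap_neg fun z => ?_
    rw [antiPart_swap, alpha_swap, dot_neg_right, dot_neg_left, Prod.fst_swap, Prod.snd_swap]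
    ring
  -- The cross-term weight is split into a swap-symmetric and a swap-antisymmetric factor, and A
  -- into its two parts. Of the four resulting terms, `z3` and `z5` kill those of mismatched parity.
  have hpt : ∀ z, dot (magGrad s A u z) (magGrad s A v z) =
      dot (fracGrad s u z) (fracGrad s v z) +
      (u z.1 - u z.2) * (v z.1 - v z.2) * dot (antiPart A z) (alpha s z) +
      (u z.1 - u z.2) * (v z.1 - v z.2) * dot (symPart A z) (alpha s z) +
      (u z.1 * v z.1 - u z.2 * v z.2) * dot (symPart A z) (alpha s z) +
      (u z.1 * v z.1 - u z.2 * v z.2) * dot (antiPart A z) (alpha s z) +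
      dot (u z.1 • A z) (v z.1 • A z) := by
    intro z
    have h1 : dot (A z) (alpha s z) =
        dot (antiPart A z) (alpha s z) + dot (symPart A z) (alpha s z) := by
      rw [← dot_add_left, antiPart, sub_add_cancel]
    have h2 := dot_comm (alpha s z) (A z)
    simp only [magGrad, fracGrad, dot_add_left, dot_add_right, dot_smul_left, dot_smul_right, h2,
      h1]
    ring
  have hmag : magLaplacian s A u v = (∫ z, dot (fracGrad s u z) (fracGrad s v z)) +
      antiForm s A u v +
      (∫ z, (u z.1 * v z.1 - u z.2 * v z.2) * dot (symPart A z) (alpha s z)) +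
      ∫ z, dot (u z.1 • A z) (v z.1 • A z) := by
    rw [magLaplacian]
    simp_rw [hpt]
    rw [integral_add j5 i6, integral_add j4 i5, integral_add j3 i4, integral_add j2 i3,
      integral_add i1 i2, z3, z5, antiForm]
    ring
  rw [magSchrodinger, hmag, h.Q_mul hΩ hu hv]
  ring

theorem MemP0.exists_enorm_Q_mul_le (hΩ : IsOpen Ω) (h : MemP0 s Ω A q) :
    ∃ C : ℝ≥0∞, C ≠ ⊤ ∧ ∀ u v : RSpace n → ℂ, HsFinite s u → HsFinite s v →
      ‖Q s A q (fun x => u x * v x)‖ₑ ≤ C * hsNorm s u * hsNorm s v := by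
  obtain ⟨K, hK⟩ := h.mulBound
  obtain ⟨Ks, hKs⟩ := hK.symPart
  obtain ⟨Kq, hKq, hq⟩ := h.exists_lintegral_q_le hΩ
  have := hK.ne_top
  have := hKs.ne_top
  refine ⟨Kq + K * K + 2 * Ks, by finiteness, fun u v hu hv => ?_⟩
  rw [h.Q_mul hΩ hu hv]
  calc _ ≤ Kq * hsNorm s u * hsNorm s v + K * hsNorm s u * (K * hsNorm s v) +
        2 * Ks * hsNorm s u * hsNorm s v := by
        refine (enorm_add_le _ _).trans (add_le_add ((enorm_add_le _ _).trans (add_le_add ?_ ?_))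
          (hKs.enorm_integral_mul_diff_le hu hv))
        · exact (enorm_integral_le_lintegral_enorm _).trans (hq u v hu.aesm hv.aesm)
        · exact (enorm_integral_le_lintegral_enorm _).trans
            ((lintegral_enorm_dot_le (hK.memLp_left hu).1 (hK.memLp_left hv).1).trans
            (mul_le_mul' (hK.left u hu.aesm) (hK.left v hv.aesm)))
    _ = _ := by ring

/-- Additivity is read off from `MemP0.Q_mul`, whose integrals all converge for these functions. -/
theorem MemP0.Q_add_mul (hΩ : IsOpen Ω) (h : MemP0 s Ω A q) {u' : RSpace n → ℂ}
    (hu : HsFinite s u) (hu' : HsFinite s u') (hv : HsFinite s v) (hadd : HsFinite s (u + u')) :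
    Q s A q (fun x => (u + u') x * v x) =
      Q s A q (fun x => u x * v x) + Q s A q (fun x => u' x * v x) := by
  obtain ⟨K, hK⟩ := h.mulBound
  obtain ⟨Ks, hKs⟩ := hK.symPart
  rw [h.Q_mul hΩ hadd hv, h.Q_mul hΩ hu hv, h.Q_mul hΩ hu' hv]
  have e1 : ∫ x, (q x : ℂ) * (u + u') x * v x =
      (∫ x, (q x : ℂ) * u x * v x) + ∫ x, (q x : ℂ) * u' x * v x := by
    rw [← integral_add (h.integrable_q_mul hΩ hu hv) (h.integrable_q_mul hΩ hu' hv)]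
    refine integral_congr_ae (Filter.Eventually.of_forall fun x => ?_)
    simp only [Pi.add_apply]
    ring
  have e2 : ∫ z : RSpace n × RSpace n, dot ((u + u') z.1 • A z) (v z.1 • A z) =
      (∫ z, dot (u z.1 • A z) (v z.1 • A z)) + ∫ z, dot (u' z.1 • A z) (v z.1 • A z) := by
    rw [← integral_add (integrable_dot (hK.memLp_left hu) (hK.memLp_left hv))
      (integrable_dot (hK.memLp_left hu') (hK.memLp_left hv))]
    refine integral_congr_ae (Filter.Eventually.of_forall fun x => ?_)
    simp only [Pi.add_apply, add_smul, dot_add_left]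
  have e3 : ∫ z : RSpace n × RSpace n,
      ((u + u') z.1 * v z.1 - (u + u') z.2 * v z.2) * dot (symPart A z) (alpha s z) =
      (∫ z, (u z.1 * v z.1 - u z.2 * v z.2) * dot (symPart A z) (alpha s z)) +
      ∫ z, (u' z.1 * v z.1 - u' z.2 * v z.2) * dot (symPart A z) (alpha s z) := by
    rw [← integral_add (hKs.integrable_mul_diff hu hv) (hKs.integrable_mul_diff hu' hv)]
    refine integral_congr_ae (Filter.Eventually.of_forall fun x => ?_)
    simp only [Pi.add_apply]
    ring
  rw [e1, e2, e3]
  ring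

end Forms

/-! ### From test functions to products of Hˢ functions -/

section Density

variable {u v : RSpace n → ℂ} {Ω : Set (RSpace n)} {A A' : RSpace n × RSpace n → CSpace n}
  {q q' : RSpace n → ℝ}

theorem hsFinite_of_contDiff (hn : 1 ≤ n) (hs : s ∈ Set.Ioo (0 : ℝ) 1) {φ : RSpace n → ℂ}
    (hφ : ContDiff ℝ ∞ φ) (hφ' : HasCompactSupport φ) : HsFinite s φ :=
  (memH_of_contDiff hφ hφ').hsFinite hn hs

/-- On (u, v) the two forms differ by at most a constant times `hsNorm` of u − φ, for any test
function φ; this tends to 0. Only one factor is varied, so that the lemma can be applied to each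
factor in turn. -/
theorem Q_mul_eq_of_contDiff_left (hn : 1 ≤ n) (hs : s ∈ Set.Ioo (0 : ℝ) 1) (hΩ : IsOpen Ω)
    (h : MemP0 s Ω A q) (h' : MemP0 s Ω A' q') (hv : HsFinite s v)
    (hφ : ∀ φ : RSpace n → ℂ, ContDiff ℝ ∞ φ → HasCompactSupport φ →
      Q s A q (fun x => φ x * v x) = Q s A' q' (fun x => φ x * v x)) (hu : MemH s u) :
    Q s A q (fun x => u x * v x) = Q s A' q' (fun x => u x * v x) := by
  obtain ⟨C, hC, hle⟩ := h.exists_enorm_Q_mul_le hΩ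
  obtain ⟨C', hC', hle'⟩ := h'.exists_enorm_Q_mul_le hΩ
  have huf := hu.hsFinite hn hs
  have key : ∀ ε : ℝ≥0∞, ε ≠ 0 → ε ≠ ⊤ →
      ‖Q s A q (fun x => u x * v x) - Q s A' q' (fun x => u x * v x)‖ₑ ≤
        (C + C') * hsNorm s v * ε := by
    intro ε hε hε'
    obtain ⟨φ, h1, h2, h3⟩ := hu.exists_contDiff_hsNorm_sub_le hn hs hε
    have hφf := hsFinite_of_contDiff hn hs h1 h2
    have hd : HsFinite s (u - φ) := ⟨huf.aesm.sub hφf.aesm, h3.trans_lt hε'.lt_top⟩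
    have hsum : HsFinite s (u - φ + φ) := by rwa [sub_add_cancel]
    have e := h.Q_add_mul hΩ hd hφf hv hsum
    have e' := h'.Q_add_mul hΩ hd hφf hv hsum
    rw [sub_add_cancel] at e e'
    rw [e, e', hφ φ h1 h2, add_sub_add_right_eq_sub]
    calc _ ≤ C * hsNorm s (u - φ) * hsNorm s v + C' * hsNorm s (u - φ) * hsNorm s v :=
          (enorm_sub_le).trans (add_le_add (hle _ _ hd hv) (hle' _ _ hd hv))
      _ ≤ C * ε * hsNorm s v + C' * ε * hsNorm s v := by gcongr
      _ = _ := by ring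
  have hlim : Filter.Tendsto (fun ε : ℝ≥0∞ => (C + C') * hsNorm s v * ε)
      (nhdsWithin 0 (Set.Ioi 0)) (nhds 0) := by
    have h1 : Filter.Tendsto (fun ε : ℝ≥0∞ => (C + C') * hsNorm s v * ε) (nhds 0)
        (nhds ((C + C') * hsNorm s v * 0)) :=
      ENNReal.Tendsto.const_mul Filter.tendsto_id
        (Or.inr (ENNReal.mul_ne_top (ENNReal.add_ne_top.2 ⟨hC, hC'⟩) hv.lt_top.ne))
    rw [mul_zero] at h1
    exact h1.mono_left nhdsWithin_le_nhds
  have hzero : ‖Q s A q (fun x => u x * v x) - Q s A' q' (fun x => u x * v x)‖ₑ ≤ 0 := by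
    refine ge_of_tendsto hlim ?_
    have hlt : ∀ᶠ ε : ℝ≥0∞ in nhdsWithin 0 (Set.Ioi 0), ε < ⊤ :=
      nhdsWithin_le_nhds (gt_mem_nhds ENNReal.zero_lt_top)
    filter_upwards [self_mem_nhdsWithin, hlt] with ε h1 h2
    exact key ε (ne_of_gt h1) h2.ne
  exact sub_eq_zero.1 (enorm_eq_zero.1 (le_antisymm hzero zero_le))

/-- If `Q` and `Q'` agree on test functions, then they agree on products of functions
in `Hˢ`. -/
theorem Q_mul_eq_of_forall_contDiff (hn : 1 ≤ n) (hs : s ∈ Set.Ioo (0 : ℝ) 1) (hΩ : IsOpen Ω)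
    (h : MemP0 s Ω A q) (h' : MemP0 s Ω A' q')
    (hQ : ∀ φ : RSpace n → ℂ, ContDiff ℝ ∞ φ → HasCompactSupport φ → Q s A q φ = Q s A' q' φ)
    (hu : MemH s u) (hv : MemH s v) :
    Q s A q (fun x => u x * v x) = Q s A' q' (fun x => u x * v x) := by
  refine Q_mul_eq_of_contDiff_left hn hs hΩ h h' (hv.hsFinite hn hs) (fun φ h1 h2 => ?_) hu
  simp_rw [mul_comm (φ _)]
  refine Q_mul_eq_of_contDiff_left hn hs hΩ h h' (hsFinite_of_contDiff hn hs h1 h2)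
    (fun ψ h3 h4 => ?_) hv
  exact hQ _ (h3.mul h1) h4.mul_right

end Density

/-! ### Symmetric kernels annihilated by functions with zero product -/

section Kernel

/-- Take a smooth f ≥ 0 that is nonzero exactly on U and compose k f with a smooth step: at each
point of U the value is eventually 1, off U it is always 0. -/
theorem exists_contDiff_tendsto_indicator {U : Set (RSpace n)} (hU : IsOpen U)
    (hb : Bornology.IsBounded U) :
    ∃ φ : ℕ → RSpace n → ℂ, (∀ k, ContDiff ℝ ∞ (φ k)) ∧ (∀ k, HasCompactSupport (φ k)) ∧
      (∀ k x, ‖φ k x‖ ≤ 1) ∧ (∀ k, ∀ x ∉ U, φ k x = 0) ∧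
      ∀ x, Filter.Tendsto (fun k => φ k x) Filter.atTop (nhds (U.indicator 1 x)) := by
  obtain ⟨f, hf1, hf2, hf3⟩ := hU.exists_contDiff_support_eq (n := ⊤)
  have hzero : ∀ k : ℕ, ∀ x ∉ U, ((Real.smoothTransition (k * f x) : ℝ) : ℂ) = 0 := by
    intro k x hx
    rw [← hf1, Function.notMem_support] at hx
    simp [hx]
  refine ⟨fun k x => ((Real.smoothTransition (k * f x) : ℝ) : ℂ), fun k => ?_, fun k => ?_,
    fun k x => ?_, hzero, fun x => ?_⟩
  · exact Complex.ofRealCLM.contDiff.comp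
      (Real.smoothTransition.contDiff.comp (contDiff_const.mul hf2))
  · refine HasCompactSupport.intro' hb.isCompact_closure isClosed_closure fun x hx => ?_
    exact hzero k x fun h => hx (subset_closure h)
  · rw [Complex.norm_real, Real.norm_of_nonneg (Real.smoothTransition.nonneg _)]
    exact Real.smoothTransition.le_one _
  · by_cases hx : x ∈ U
    · rw [Set.indicator_of_mem hx]
      have hpos : 0 < f x := by
        have h1 : f x ≠ 0 := by rwa [← Function.mem_support, hf1]
        exact lt_of_le_of_ne (hf3 ⟨x, rfl⟩).1 h1.symm
      refine tendsto_const_nhds.congr' ?_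
      obtain ⟨N, hN⟩ := exists_nat_gt (1 / f x)
      filter_upwards [Filter.eventually_ge_atTop N] with k hk
      have h2 : (N : ℝ) ≤ k := by exact_mod_cast hk
      rw [div_lt_iff₀ hpos] at hN
      rw [Real.smoothTransition.one_of_one_le (by nlinarith)]
      simp
    · rw [Set.indicator_of_notMem hx]
      simp_rw [hzero _ x hx]
      exact tendsto_const_nhds

/-- An integrable function on a product whose integrals over open rectangles vanish is zero. -/
theorem ae_eq_zero_of_forall_rectangle {ν : Measure (RSpace n × RSpace n)}
    {K : RSpace n × RSpace n → ℂ} (hK : Integrable K ν)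
    (h : ∀ U V : Set (RSpace n), IsOpen U → IsOpen V → ∫ z in U ×ˢ V, K z ∂ν = 0) :
    K =ᵐ[ν] 0 := by
  refine hK.ae_eq_zero_of_forall_setIntegral_eq_zero fun t ht _ => ?_
  -- The whole space is itself an open rectangle; this supplies the complement step of the π-λ
  -- argument.
  have huniv : ∫ z, K z ∂ν = 0 := by
    simpa using h Set.univ Set.univ isOpen_univ isOpen_univ
  have hgen : (inferInstance : MeasurableSpace (RSpace n × RSpace n)) =
      MeasurableSpace.generateFrom (Set.image2 (· ×ˢ ·) {U : Set (RSpace n) | IsOpen U}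
        {V : Set (RSpace n) | IsOpen V}) := by
    refine (generateFrom_eq_prod ?_ ?_ ?_ ?_).symm
    · exact (BorelSpace.measurable_eq (α := RSpace n)).symm
    · exact (BorelSpace.measurable_eq (α := RSpace n)).symm
    · exact ⟨fun _ => Set.univ, fun _ => by simp, Set.iUnion_const _⟩
    · exact ⟨fun _ => Set.univ, fun _ => by simp, Set.iUnion_const _⟩
  have hpi : IsPiSystem (Set.image2 (· ×ˢ ·) {U : Set (RSpace n) | IsOpen U}
        {V : Set (RSpace n) | IsOpen V}) :=
    IsPiSystem.prod isPiSystem_isOpen isPiSystem_isOpen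
  refine MeasurableSpace.induction_on_inter (C := fun t _ => ∫ z in t, K z ∂ν = 0) hgen hpi
    (by simp) ?_ ?_ ?_ t ht
  · rintro _ ⟨U, hU, V, hV, rfl⟩
    exact h U V hU hV
  · intro t ht h0
    have h1 := integral_add_compl ht hK
    rw [h0, zero_add, huniv] at h1
    exact h1
  · intro f hd hm h0
    rw [integral_iUnion hm hd hK.integrableOn]
    simp [h0]

/-- If uv = 0, the weight is −(u(x)v(y) + u(y)v(x)), and symmetry of K makes the integral −2 ∫
u(x)v(y)K. Around an off-diagonal point u and v may approximate indicators of open sets in two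
disjoint balls, so K integrates to 0 over small rectangles and is locally null. -/
theorem ae_eq_zero_of_diff_mul_diff {K : RSpace n × RSpace n → ℂ} (hsymm : ∀ z, K z.swap = K z)
    (hinteg : ∀ u v : RSpace n → ℂ, ContDiff ℝ ∞ u → HasCompactSupport u → ContDiff ℝ ∞ v →
      HasCompactSupport v → Integrable fun z => (u z.1 - u z.2) * (v z.1 - v z.2) * K z)
    (h0 : ∀ u v : RSpace n → ℂ, ContDiff ℝ ∞ u → HasCompactSupport u → ContDiff ℝ ∞ v →
      HasCompactSupport v → (∀ x, u x * v x = 0) →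
      ∫ z, (u z.1 - u z.2) * (v z.1 - v z.2) * K z = 0) :
    ∀ᵐ z : RSpace n × RSpace n, z.1 ≠ z.2 → K z = 0 := by
  rw [ae_iff]
  refine measure_null_of_locally_null _ fun z₀ hz₀ => ?_
  have hne : z₀.1 ≠ z₀.2 := by
    intro h
    simp [h] at hz₀
  set r := dist z₀.1 z₀.2 / 4 with hr
  have hr0 : 0 < r := by
    have := dist_pos.2 hne
    positivity
  set B₁ := Metric.ball z₀.1 r
  set B₂ := Metric.ball z₀.2 r
  have hsep : ∀ y ∈ B₂, 2 * r ≤ dist y z₀.1 := by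
    intro y hy
    have h1 := dist_triangle_left z₀.1 z₀.2 y
    have h2 : dist y z₀.2 < r := hy
    linarith
  have hdisj : Disjoint B₁ B₂ := by
    refine Metric.ball_disjoint_ball ?_
    linarith
  have hmeasW : MeasurableSet (B₁ ×ˢ B₂) := measurableSet_ball.prod measurableSet_ball
  -- Choose u = v = χ with χ = 1 on `B₁` and χ = 0 on `B₂`: the weight is 1 on the rectangle, so the
  -- assumed integrability passes to K.
  have hKW : IntegrableOn K (B₁ ×ˢ B₂) := by
    let χ : ContDiffBump z₀.1 := ⟨r, 2 * r, hr0, by linarith⟩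
    have h1 : ContDiff ℝ ∞ fun x => ((χ x : ℝ) : ℂ) := Complex.ofRealCLM.contDiff.comp χ.contDiff
    have h2 : HasCompactSupport fun x => ((χ x : ℝ) : ℂ) :=
      χ.hasCompactSupport.comp_left (g := fun r : ℝ => (r : ℂ)) Complex.ofReal_zero
    refine (hinteg _ _ h1 h2 h1 h2).integrableOn.congr_fun (fun z hz => ?_) hmeasW
    have e1 : χ z.1 = 1 := χ.one_of_mem_closedBall (Metric.ball_subset_closedBall hz.1)
    have e2 : χ z.2 = 0 := χ.zero_of_le_dist (hsep z.2 hz.2)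
    simp [e1, e2]
  have hrect : ∀ U V : Set (RSpace n), IsOpen U → IsOpen V → U ⊆ B₁ → V ⊆ B₂ →
      ∫ z in U ×ˢ V, K z = 0 := by
    intro U V hU hV hUB hVB
    obtain ⟨φ, a1, a2, a3, a4, a5⟩ :=
      exists_contDiff_tendsto_indicator hU (Metric.isBounded_ball.subset hUB)
    obtain ⟨ψ, b1, b2, b3, b4, b5⟩ :=
      exists_contDiff_tendsto_indicator hV (Metric.isBounded_ball.subset hVB)
    have hG : Integrable ((B₁ ×ˢ B₂).indicator K) := hKW.integrable_indicator hmeasW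
    have hFG : ∀ k z, φ k z.1 * ψ k z.2 * K z =
        φ k z.1 * ψ k z.2 * (B₁ ×ˢ B₂).indicator K z := by
      intro k z
      by_cases hz : z ∈ B₁ ×ˢ B₂
      · rw [Set.indicator_of_mem hz]
      · rw [Set.mem_prod, not_and_or] at hz
        rcases hz with hz | hz
        · rw [a4 k _ fun h => hz (hUB h)]
          simp
        · rw [b4 k _ fun h => hz (hVB h)]
          simp
    have hmeas : ∀ k, AEStronglyMeasurable fun z : RSpace n × RSpace n =>
        φ k z.1 * ψ k z.2 * K z := by
      intro k
      simp_rw [hFG]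
      have := (a1 k).continuous
      have := (b1 k).continuous
      exact Continuous.aestronglyMeasurable (by fun_prop) |>.mul hG.1
    have hbd : ∀ k z, ‖φ k z.1 * ψ k z.2 * K z‖ ≤ ‖(B₁ ×ˢ B₂).indicator K z‖ := by
      intro k z
      rw [hFG, norm_mul, norm_mul]
      exact mul_le_of_le_one_left (norm_nonneg _)
        (mul_le_one₀ (a3 k _) (norm_nonneg _) (b3 k _))
    have hFint : ∀ k, Integrable fun z : RSpace n × RSpace n => φ k z.1 * ψ k z.2 * K z :=
      fun k => hG.norm.mono' (hmeas k) (Filter.Eventually.of_forall (hbd k))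
    have hzero : ∀ k, ∫ z : RSpace n × RSpace n, φ k z.1 * ψ k z.2 * K z = 0 := by
      intro k
      have hprod : ∀ x, φ k x * ψ k x = 0 := by
        intro x
        by_cases hx : x ∈ U
        · rw [b4 k x fun h => Set.disjoint_left.1 hdisj (hUB hx) (hVB h), mul_zero]
        · rw [a4 k x hx, zero_mul]
      have e1 := h0 _ _ (a1 k) (a2 k) (b1 k) (b2 k) hprod
      have e2 := integral_swap_eq fun z : RSpace n × RSpace n => φ k z.1 * ψ k z.2 * K z
      have e3 : ∫ z : RSpace n × RSpace n, (φ k z.1 - φ k z.2) * (ψ k z.1 - ψ k z.2) * K z =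
          -((∫ z : RSpace n × RSpace n, φ k z.1 * ψ k z.2 * K z) +
            ∫ z : RSpace n × RSpace n, φ k z.swap.1 * ψ k z.swap.2 * K z.swap) := by
        have hsw : Integrable fun z : RSpace n × RSpace n =>
            φ k z.swap.1 * ψ k z.swap.2 * K z.swap := (hFint k).swap
        rw [← integral_add (hFint k) hsw, ← integral_neg]
        refine integral_congr_ae (Filter.Eventually.of_forall fun z => ?_)
        simp only [Prod.fst_swap, Prod.snd_swap, hsymm]
        linear_combination (K z) * hprod z.1 + (K z) * hprod z.2
      rw [e3, e2, neg_eq_zero, ← two_mul] at e1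
      exact (mul_eq_zero.1 e1).resolve_left two_ne_zero
    have hlim : Filter.Tendsto (fun k => ∫ z : RSpace n × RSpace n, φ k z.1 * ψ k z.2 * K z)
        Filter.atTop (nhds (∫ z, (U ×ˢ V).indicator K z)) := by
      refine tendsto_integral_of_dominated_convergence _ hmeas hG.norm
        (fun k => Filter.Eventually.of_forall (hbd k)) (Filter.Eventually.of_forall fun z => ?_)
      have h1 := ((a5 z.1).mul (b5 z.2)).mul_const (K z)
      convert h1 using 2
      by_cases hz1 : z.1 ∈ U <;> by_cases hz2 : z.2 ∈ V <;> simp [Set.indicator, hz1, hz2]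
    simp_rw [hzero] at hlim
    rw [← integral_indicator (hU.measurableSet.prod hV.measurableSet)]
    exact tendsto_nhds_unique hlim tendsto_const_nhds
  have hae : K =ᵐ[volume.restrict (B₁ ×ˢ B₂)] 0 := by
    refine ae_eq_zero_of_forall_rectangle hKW fun U V hU hV => ?_
    rw [Measure.restrict_restrict (hU.measurableSet.prod hV.measurableSet), Set.prod_inter_prod]
    exact hrect _ _ (hU.inter Metric.isOpen_ball) (hV.inter Metric.isOpen_ball)
      Set.inter_subset_right Set.inter_subset_right
  rw [Filter.EventuallyEq, ae_restrict_iff' hmeasW, ae_iff] at hae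
  refine ⟨_, ?_, hae⟩
  have hW : B₁ ×ˢ B₂ ∈ nhds z₀ :=
    (Metric.isOpen_ball.prod Metric.isOpen_ball).mem_nhds
      ⟨Metric.mem_ball_self hr0, Metric.mem_ball_self hr0⟩
  filter_upwards [mem_nhdsWithin_of_mem_nhds hW, self_mem_nhdsWithin] with z h1 h2
  intro h3
  exact h2 fun _ => h3 h1

/-- The slices of the diagonal are points, which are null because n ≥ 1. -/
theorem ae_fst_ne_snd (hn : 1 ≤ n) : ∀ᵐ z : RSpace n × RSpace n, z.1 ≠ z.2 := by
  have : Nonempty (Fin n) := ⟨⟨0, hn⟩⟩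
  have hm : MeasurableSet {z : RSpace n × RSpace n | ¬ z.1 ≠ z.2} := by
    simp only [ne_eq, not_not]
    exact measurableSet_eq_fun measurable_fst measurable_snd
  rw [ae_iff, Measure.volume_eq_prod, Measure.measure_prod_null hm]
  refine Filter.Eventually.of_forall fun x => ?_
  simp

end Kernel

/-! ### Recovering the antisymmetric parallel part and Q -/

section Gauge

variable {u v : RSpace n → ℂ} {Ω : Set (RSpace n)} {A A' : RSpace n × RSpace n → CSpace n}
  {q q' : RSpace n → ℝ}

/-- Off the diagonal, `α(x,y)` is a nonzero multiple of `x - y`. -/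
theorem exists_alpha_eq_smul (hn : 1 ≤ n) (hs : s ∈ Set.Ioo (0 : ℝ) 1) {z : RSpace n × RSpace n}
    (hz : z.1 ≠ z.2) : ∃ r : ℂ, r ≠ 0 ∧ alpha s z = r • toC (z.1 - z.2) := by
  have h0 : 0 < ‖z.2 - z.1‖ := norm_pos_iff.2 (sub_ne_zero.2 hz.symm)
  have hC := fracConst_pos hn hs
  have hpos : 0 < Real.sqrt (fracConst n s) / Real.sqrt 2 /
      ‖z.2 - z.1‖ ^ ((n : ℝ) / 2 + s + 1) := by positivity
  refine ⟨((-(Real.sqrt (fracConst n s) / Real.sqrt 2 /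
    ‖z.2 - z.1‖ ^ ((n : ℝ) / 2 + s + 1)) : ℝ) : ℂ), ?_, ?_⟩
  · exact_mod_cast neg_ne_zero.2 hpos.ne'
  · rw [← toC_smul, alpha, ← neg_sub z.1 z.2, smul_neg, neg_smul, norm_neg]

/-- The parallel part depends on B only through its product with x − y, and positivity of
`fracConst` makes α a nonzero multiple of x − y. -/
theorem parPart_eq_of_dot_alpha_eq (hn : 1 ≤ n) (hs : s ∈ Set.Ioo (0 : ℝ) 1)
    {B B' : RSpace n × RSpace n → CSpace n} {z : RSpace n × RSpace n} (hz : z.1 ≠ z.2)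
    (h : dot (B z) (alpha s z) = dot (B' z) (alpha s z)) : parPart B z = parPart B' z := by
  obtain ⟨r, hr, hα⟩ := exists_alpha_eq_smul hn hs hz
  rw [hα, dot_smul_right, dot_smul_right] at h
  rw [parPart, parPart, if_neg hz, if_neg hz, mul_left_cancel₀ hr h]

theorem antiForm_congr (h : parPart (antiPart A) =ᵐ[volume] parPart (antiPart A')) :
    antiForm s A u v = antiForm s A' u v := by
  refine integral_congr_ae (h.mono fun z hz => ?_)
  simp only
  rw [← dot_parPart_alpha, hz, dot_parPart_alpha]

theorem Q_zero (s : ℝ) (A : RSpace n × RSpace n → CSpace n) (q : RSpace n → ℝ) :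
    Q s A q (fun _ => 0) = 0 := by
  have h : ∀ a : CSpace n, dot a 0 = 0 := fun a => by simp [dot]
  simp [Q, fracDiv, fracGrad, h]

theorem GaugeEquiv.antiForm_add_Q_eq (hn : 1 ≤ n) (hs : s ∈ Set.Ioo (0 : ℝ) 1) (hΩ : IsOpen Ω)
    (h : MemP0 s Ω A q) (h' : MemP0 s Ω A' q') (hg : GaugeEquiv s A q A' q') (hu : MemH s u)
    (hv : MemH s v) :
    antiForm s A u v + Q s A q (fun x => u x * v x) =
      antiForm s A' u v + Q s A' q' (fun x => u x * v x) := by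
  have e := hg u hu v hv
  rw [h.magSchrodinger_eq hΩ (hu.hsFinite hn hs) (hv.hsFinite hn hs),
    h'.magSchrodinger_eq hΩ (hu.hsFinite hn hs) (hv.hsFinite hn hs), add_assoc, add_assoc] at e
  exact add_left_cancel e

/-- Pairs with uv = 0 remove both Q terms. The remaining kernel is swap-symmetric, as a product of
two antisymmetric factors, and must vanish off the diagonal. -/
theorem GaugeEquiv.parPart_antiPart_ae_eq (hn : 1 ≤ n) (hs : s ∈ Set.Ioo (0 : ℝ) 1)
    (hΩ : IsOpen Ω) (h : MemP0 s Ω A q) (h' : MemP0 s Ω A' q') (hg : GaugeEquiv s A q A' q') :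
    parPart (antiPart A) =ᵐ[volume] parPart (antiPart A') := by
  obtain ⟨K, hK⟩ := h.mulBound
  obtain ⟨K', hK'⟩ := h'.mulBound
  obtain ⟨L, hL⟩ := hK.antiPart
  obtain ⟨L', hL'⟩ := hK'.antiPart
  have hker := ae_eq_zero_of_diff_mul_diff
    (K := fun z => dot (antiPart A z) (alpha s z) - dot (antiPart A' z) (alpha s z))
    (fun z => by
      simp only [antiPart_swap, alpha_swap, dot_neg_left, dot_neg_right, neg_neg])
    (fun u v hu hu' hv hv' => by
      have hu2 := hsFinite_of_contDiff hn hs hu hu'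
      have hv2 := hsFinite_of_contDiff hn hs hv hv'
      simp_rw [mul_sub _ (dot _ _)]
      exact (hL.integrable_diff_mul_diff hu2 hv2).sub (hL'.integrable_diff_mul_diff hu2 hv2))
    (fun u v hu hu' hv hv' huv => by
      have hu2 := hsFinite_of_contDiff hn hs hu hu'
      have hv2 := hsFinite_of_contDiff hn hs hv hv'
      have e := hg.antiForm_add_Q_eq hn hs hΩ h h' (memH_of_contDiff hu hu')
        (memH_of_contDiff hv hv')
      simp_rw [huv] at e
      rw [Q_zero, Q_zero, add_zero, add_zero] at e
      simp_rw [mul_sub _ (dot _ _)]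
      rw [integral_sub (hL.integrable_diff_mul_diff hu2 hv2)
        (hL'.integrable_diff_mul_diff hu2 hv2)]
      exact sub_eq_zero.2 e)
  filter_upwards [hker, ae_fst_ne_snd hn] with z h1 h2
  exact parPart_eq_of_dot_alpha_eq hn hs h2 (sub_eq_zero.1 (h1 h2))

theorem GaugeEquiv.Q_eq (hn : 1 ≤ n) (hs : s ∈ Set.Ioo (0 : ℝ) 1) (hΩ : IsOpen Ω)
    (h : MemP0 s Ω A q) (h' : MemP0 s Ω A' q') (hg : GaugeEquiv s A q A' q')
    {φ : RSpace n → ℂ} (hφ : ContDiff ℝ ∞ φ) (hφ' : HasCompactSupport φ) :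
    Q s A q φ = Q s A' q' φ := by
  obtain ⟨R, hR0, hR⟩ := hφ'.isBounded.subset_closedBall_lt 0 0
  -- χ = 1 on the support of φ, so φχ = φ: a single test function is a product of two, to which the
  -- form identity applies.
  let χ : ContDiffBump (0 : RSpace n) := ⟨R, 2 * R, hR0, by linarith⟩
  have h1 : ContDiff ℝ ∞ fun x => ((χ x : ℝ) : ℂ) := Complex.ofRealCLM.contDiff.comp χ.contDiff
  have h2 : HasCompactSupport fun x => ((χ x : ℝ) : ℂ) :=
    χ.hasCompactSupport.comp_left (g := fun r : ℝ => (r : ℂ)) Complex.ofReal_zero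
  have e := hg.antiForm_add_Q_eq hn hs hΩ h h' (memH_of_contDiff hφ hφ') (memH_of_contDiff h1 h2)
  rw [antiForm_congr (hg.parPart_antiPart_ae_eq hn hs hΩ h h')] at e
  have e2 : (fun x => φ x * ((χ x : ℝ) : ℂ)) = φ := by
    ext x
    by_cases hx : x ∈ tsupport φ
    · rw [χ.one_of_mem_closedBall (hR hx)]
      simp
    · rw [image_eq_zero_of_notMem_tsupport hx, zero_mul]
  rw [e2] at e
  exact add_left_cancel e

end Gauge

end FracMag

end

theorem mainTheorem3 (n : ℕ) (hn : 1 ≤ n) (s : ℝ) (hs : s ∈ Set.Ioo (0 : ℝ) 1)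
    (Ω : Set (FracMag.RSpace n)) (hΩ : IsOpen Ω)
    (A A' : FracMag.RSpace n × FracMag.RSpace n → FracMag.CSpace n)
    (q q' : FracMag.RSpace n → ℝ)
    (h : FracMag.MemP0 s Ω A q) (h' : FracMag.MemP0 s Ω A' q') :
    FracMag.GaugeEquiv s A q A' q' ↔
      (FracMag.parPart (FracMag.antiPart A) =ᵐ[MeasureTheory.volume]
          FracMag.parPart (FracMag.antiPart A')) ∧
        ∀ φ : FracMag.RSpace n → ℂ, ContDiff ℝ ∞ φ → HasCompactSupport φ →
          FracMag.Q s A q φ = FracMag.Q s A' q' φ := by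
  constructor
  · intro hg
    exact ⟨hg.parPart_antiPart_ae_eq hn hs hΩ h h', fun φ hφ hφ' =>
      hg.Q_eq hn hs hΩ h h' hφ hφ'⟩
  · rintro ⟨hA, hQ⟩ u hu v hv
    rw [h.magSchrodinger_eq hΩ (hu.hsFinite hn hs) (hv.hsFinite hn hs),
      h'.magSchrodinger_eq hΩ (hu.hsFinite hn hs) (hv.hsFinite hn hs),
      FracMag.antiForm_congr hA, FracMag.Q_mul_eq_of_forall_contDiff hn hs hΩ h h' hQ hu hv]
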